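/- All graphs are finite, simple and undirected. A graph is \emph{equimatchable} if each of its (inclusion-)maximal matchings is a maximum matching; it is \emph{factor-critical} if $G-v$ has a perfect matching for every vertex $v$; an \emph{EFC-graph} is an equimatchable factor-critical graph. For a graph $H$ on vertices $u_1,\dots,u_k$ and nonnegative integers $m_1,\dots,m_k$, let $H(m_1,\dots,m_k)$ be the graph obtained from $H$ by replacing each $u_i$ with an independent set of $m_i$ vertices (deleting $u_i$ if $m_i=0$), where copies of $u_i$ and $u_j$ are adjacent if and only if $u_iu_j\in E(H)$. Let $G_1$ be the cycle $u_1u_7u_6u_5u_4u_3u_2u_1$ on seven vertices, and let $G_2$ be the graph on $u_1,\dots,u_{11}$ with the 15 edges $u_1u_6$, $u_6u_7$, $u_7u_{11}$, $u_{11}u_{10}$, $u_{10}u_9$, $u_9u_4$, $u_4u_3$, $u_3u_2$, $u_2u_1$, $u_7u_8$, $u_6u_5$, $u_2u_5$, $u_{10}u_8$, $u_4u_5$, $u_4u_8$. Define the following families of graphs (up to isomorphism; $n,r,s$ are integers): - $\mathcal F_{11}=\{G_2(n,n,0,1,1,1,1,1,0,0,0) : n\ge 1\}$; - $\mathcal F_{12}=\{G_1(n,n,1,1,1,1,1)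 : n\ge 2\}$; - $\mathcal F_{21}=\{G_2(r,n,s,1,n+1-r-s,1,1,1,0,0,0) : n\ge 1,\ 0\le r\le n-1,\ 0\le s\le n-1,\ r+s\le n+1\}$; - $\mathcal F_{22}=\{G_1(n,r,1,1,1,1,n-r+1) : n\ge 2,\ 1\le r\le n\}$; - $\mathcal F_{3}=\{G_2(0,0,0,1,1,1,r,s,0,n+1-r,n+1-s) : n\ge 1,\ 1\le r\le n+1,\ 1\le s\le n+1\}$; - $\mathcal F_{4}=\{G_2(0,0,0,1,1,r,n+1,s,0,0,n+2-r-s) : n\ge 2,\ 2\le r\le n,\ 2\le s\le n,\ r+s\le n+2\}$. \textbf{Theorem.} A graph $G$ is a connected triangle-free EFC-graph that has an induced odd cycle $C$ such that $G\setminus V(C)$ is nonempty and connected if and only if $G\in\mathcal F=\mathcal F_{11}\cup\mathcal F_{12}\cup\mathcal F_{21}\cup\mathcal F_{22}\cup\mathcal F_3\cup\mathcal F_4$. -/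

import Mathlib

namespace EFC

universe u

/-- A matching `M` of `G` (its vertices are the saturated ones) that is contained in no other
matching of `G`. -/
def IsMaximalMatching {V : Type u} {G : SimpleGraph V} (M : G.Subgraph) : Prop :=
  Maximal (fun M' : G.Subgraph => M'.IsMatching) M

/-- A matching of `G` with the largest possible number of edges. -/
def IsMaximumMatching {V : Type u} {G : SimpleGraph V} (M : G.Subgraph) : Prop :=
  M.IsMatching ∧ ∀ M' : G.Subgraph, M'.IsMatching → M'.edgeSet.ncard ≤ M.edgeSet.ncard

/-- Every maximal matching is a maximum matching (used for finite graphs). -/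
def Equimatchable {V : Type u} (G : SimpleGraph V) : Prop :=
  ∀ M : G.Subgraph, IsMaximalMatching M → IsMaximumMatching M

/-- Deleting any single vertex leaves a graph with a perfect matching. -/
def FactorCritical {V : Type u} (G : SimpleGraph V) : Prop :=
  ∀ v : V, ∃ M : (G.induce ({v}ᶜ : Set V)).Subgraph, M.IsPerfectMatching

/-- `C` is the vertex set of an induced cycle of `G` of odd length `2 * k + 1 ≥ 3`. -/
def IsInducedOddCycle {V : Type u} (G : SimpleGraph V) (C : Set V) : Prop :=
  ∃ k : ℕ, 1 ≤ k ∧ Nonempty (G.induce C ≃g SimpleGraph.cycleGraph (2 * k + 1))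

/-- The graph `H(m)`: each vertex `i` of `H` is replaced by `m i` pairwise nonadjacent copies
(no copy at all if `m i = 0`), and copies of `i` and `j` are adjacent iff `i` and `j` are. -/
def blowup {ι : Type} (H : SimpleGraph ι) (m : ι → ℕ) : SimpleGraph (Σ i, Fin (m i)) :=
  H.comap Sigma.fst

/-- The cycle `u₁ u₇ u₆ u₅ u₄ u₃ u₂`; the vertex `uᵢ` is `i - 1 : Fin 7`. -/
def G₁ : SimpleGraph (Fin 7) :=
  SimpleGraph.fromEdgeSet
    {s(0, 6), s(6, 5), s(5, 4), s(4, 3), s(3, 2), s(2, 1), s(1, 0)}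

/-- The graph on `u₁, …, u₁₁` whose edges are those of the cycle
`u₁ u₆ u₇ u₁₁ u₁₀ u₉ u₄ u₃ u₂` together with `u₇u₈`, `u₆u₅`, `u₂u₅`, `u₁₀u₈`, `u₄u₅`, `u₄u₈`;
the vertex `uᵢ` is `i - 1 : Fin 11`. -/
def G₂ : SimpleGraph (Fin 11) :=
  SimpleGraph.fromEdgeSet
    {s(0, 5), s(5, 6), s(6, 10), s(10, 9), s(9, 8), s(8, 3), s(3, 2), s(2, 1), s(1, 0),
      s(6, 7), s(5, 4), s(1, 4), s(9, 7), s(3, 4), s(3, 7)}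

/-- `G` is (isomorphic to) `G₁(m)`. -/
def IsG₁ {V : Type u} (G : SimpleGraph V) (m : Fin 7 → ℕ) : Prop :=
  Nonempty (G ≃g blowup G₁ m)

/-- `G` is (isomorphic to) `G₂(m)`. -/
def IsG₂ {V : Type u} (G : SimpleGraph V) (m : Fin 11 → ℕ) : Prop :=
  Nonempty (G ≃g blowup G₂ m)

/-! In the families below every natural-number subtraction is between numbers whose difference is
nonnegative, so it never truncates. -/

def F₁₁ {V : Type u} (G : SimpleGraph V) : Prop :=
  ∃ n : ℕ, 1 ≤ n ∧ IsG₂ G ![n, n, 0, 1, 1, 1, 1, 1, 0, 0, 0]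

def F₁₂ {V : Type u} (G : SimpleGraph V) : Prop :=
  ∃ n : ℕ, 2 ≤ n ∧ IsG₁ G ![n, n, 1, 1, 1, 1, 1]

def F₂₁ {V : Type u} (G : SimpleGraph V) : Prop :=
  ∃ n r s : ℕ, 1 ≤ n ∧ r ≤ n - 1 ∧ s ≤ n - 1 ∧ r + s ≤ n + 1 ∧
    IsG₂ G ![r, n, s, 1, n + 1 - (r + s), 1, 1, 1, 0, 0, 0]

def F₂₂ {V : Type u} (G : SimpleGraph V) : Prop :=
  ∃ n r : ℕ, 2 ≤ n ∧ 1 ≤ r ∧ r ≤ n ∧ IsG₁ G ![n, r, 1, 1, 1, 1, n - r + 1]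

def F₃ {V : Type u} (G : SimpleGraph V) : Prop :=
  ∃ n r s : ℕ, 1 ≤ n ∧ 1 ≤ r ∧ r ≤ n + 1 ∧ 1 ≤ s ∧ s ≤ n + 1 ∧
    IsG₂ G ![0, 0, 0, 1, 1, 1, r, s, 0, n + 1 - r, n + 1 - s]

def F₄ {V : Type u} (G : SimpleGraph V) : Prop :=
  ∃ n r s : ℕ, 2 ≤ n ∧ 2 ≤ r ∧ r ≤ n ∧ 2 ≤ s ∧ s ≤ n ∧ r + s ≤ n + 2 ∧
    IsG₂ G ![0, 0, 0, 1, 1, r, n + 1, s, 0, 0, n + 2 - (r + s)]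

end EFC

/-!
A matching of an equimatchable factor-critical graph leaves a single vertex uncovered as soon as
the uncovered vertices are pairwise nonadjacent, and conversely this condition implies
equimatchability (`UncoversAtMostOne`). Everything below is extracted from it by exhibiting
suitable matchings, which are recorded only through the sets they saturate (`Matchable`).

Let `C` be an induced odd cycle with connected complement `D`. A maximal matching of `D` is
perfect: together with the perfect matchings of the paths `C - c` it shows that the uncovered
vertices of `D` dominate `C` and that there are at most two of them, so that their neighbourhoods
would properly 2-colour an odd cycle (`IsCyc.eq_of_isolating`). Hence the ends of every path on
four vertices of `D` are adjacent, and the connected triangle-free graph `D` is a balanced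
complete bipartite graph with parts `A` and `B` (`IsCyc.exists_isDecomp`).

If `c` on `C` is adjacent to a vertex of `A`, then matching that edge and leaving uncovered a
vertex `b` of `B` and two vertices of the path `C - c`, at an odd and a later, not consecutive,
even position, shows that `b` is adjacent to one of these two (`IsDecomp.adj_or_adj`). Long cycles thereby force
vertices with three neighbours on `C`, and such a vertex gives a shorter induced odd cycle whose
complement is still connected (`IsDecomp.exists_shorter`). So a shortest choice of `C` has length
five or seven, and every vertex off it has at most two neighbours on it (`exists_short_isDecomp`).
In the heptagon case all vertices of `A` and `B` are clones of vertices of `C`, which gives `F₂₂`.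
In the pentagon case the sets of vertices of `C` seen from `A` and from `B` are disjoint, so one
of them, by symmetry that of `A`, has at most two elements. A single one gives `F₁₁` or `F₂₁`, two
at distance two give `F₃` or `F₄`, unless `B` sees a single vertex, and two consecutive ones are
impossible.

Conversely, a blow-up in one of the families contains such a decomposition, from which
connectedness and factor-criticality follow (`properties_of_classes`), and the condition on
uncovered vertices is linear arithmetic in the numbers of matching edges between the classes
(`uncoversAtMostOne_of_classes`). The graphs of `F₁₂`, and those of `F₂₁` in which the class of
`u₅` is empty, also belong to `F₂₂`.
-/

namespace EFC

open Finset

/-! ### Matchable vertex sets -/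

/-- The finite vertex set `S` is saturated by some matching of `G` whose edges lie inside `S`. -/
inductive Matchable {V : Type*} [DecidableEq V] (G : SimpleGraph V) : Finset V → Prop
  | empty : Matchable G ∅
  | insert {a b : V} {S : Finset V} : G.Adj a b → a ∉ S → b ∉ S → Matchable G S →
      Matchable G (Insert.insert a (Insert.insert b S))

section Matchable

variable {V : Type*} [DecidableEq V] {G : SimpleGraph V}

theorem Matchable.union {S T : Finset V} (hS : Matchable G S) (hT : Matchable G T)
    (h : Disjoint S T) : Matchable G (S ∪ T) := by
  induction hS with
  | empty => simpa using hT
  | @insert a b S hab ha hb _ ih =>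
    simp only [disjoint_insert_left] at h
    rw [insert_union, insert_union]
    exact .insert hab (by simp [ha, h.1]) (by simp [hb, h.2.1]) (ih h.2.2)

theorem exists_isMatching_of_matchable {S : Finset V} (hS : Matchable G S) :
    ∃ M : G.Subgraph, M.IsMatching ∧ M.verts = S := by
  induction hS with
  | empty => exact ⟨⊥, fun v hv => absurd hv (by simp), by simp⟩
  | @insert a b S hab ha hb _ ih =>
    obtain ⟨M, hM, hv⟩ := ih
    have h2 := SimpleGraph.Subgraph.IsMatching.subgraphOfAdj hab
    refine ⟨G.subgraphOfAdj hab ⊔ M, h2.sup hM ?_, ?_⟩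
    · rw [h2.support_eq_verts, hM.support_eq_verts, hv]
      simp [ha, hb]
    · ext x
      simp [hv, or_assoc]

/-- The vertices saturated by a matching form a matchable set. -/
theorem matchable_verts_of_isMatching {M : G.Subgraph} (hM : M.IsMatching) (S : Finset V)
    (hS : ∀ v, v ∈ S ↔ v ∈ M.verts) : Matchable G S := by
  -- any set of saturated vertices that is closed under taking partners is matchable
  suffices h : ∀ n (T : Finset V), #T = n → (∀ v ∈ T, v ∈ M.verts) →
      (∀ v ∈ T, ∀ w, M.Adj v w → w ∈ T) → Matchable G T from
    h _ S rfl (fun v => (hS v).1) fun v _ w hvw => (hS w).2 (M.edge_vert hvw.symm)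
  intro n
  induction n using Nat.strong_induction_on with
  | _ n ih =>
    intro T hn hT hcl
    obtain rfl | ⟨v, hv⟩ := T.eq_empty_or_nonempty
    · exact .empty
    obtain ⟨w, hvw, -⟩ := hM (hT v hv)
    have hw := hcl v hv w hvw
    have hne : v ≠ w := (M.adj_sub hvw).ne
    have hlt : #((T.erase v).erase w) < n := by
      rw [← hn]
      exact lt_of_le_of_lt (card_le_card (erase_subset _ _)) (card_erase_lt_of_mem hv)
    have := ih _ hlt _ rfl (fun x hx => hT x (mem_of_mem_erase (mem_of_mem_erase hx))) (by
      intro x hx y hxy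
      simp only [mem_erase] at hx ⊢
      refine ⟨?_, ?_, hcl x hx.2.2 y hxy⟩
      · rintro rfl
        exact hx.2.1 (hM.eq_of_adj_right hxy hvw)
      · rintro rfl
        exact hx.1 (hM.eq_of_adj_left hxy.symm hvw))
    have h2 := Matchable.insert (M.adj_sub hvw) (by simp) (by simp) this
    rwa [insert_erase (by simp [hw, hne.symm]), insert_erase hv] at h2

/-- A maximal matching inside `D` leaves an independent set of `D` uncovered. -/
theorem exists_matchable_subset_isolating (G : SimpleGraph V) (D : Finset V) :
    ∃ T ⊆ D, Matchable G T ∧ ∀ x ∈ D \ T, ∀ y ∈ D \ T, ¬ G.Adj x y := by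
  classical
  obtain ⟨T, hT, hmax⟩ := exists_max_image (D.powerset.filter (Matchable G)) card
    ⟨∅, by simp [Matchable.empty]⟩
  simp only [mem_filter, mem_powerset] at hT hmax
  refine ⟨T, hT.1, hT.2, fun x hx y hy hxy => ?_⟩
  simp only [mem_sdiff] at hx hy
  have := hmax (insert x (insert y T))
    ⟨by simp [insert_subset_iff, hx.1, hy.1, hT.1], .insert hxy hx.2 hy.2 hT.2⟩
  rw [card_insert_of_notMem (by simp [hx.2, hxy.ne]), card_insert_of_notMem hy.2] at this
  omega

theorem matchable_of_complete_bipartite (A B : Finset V) (hAB : Disjoint A B)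
    (hc : #A = #B) (hadj : ∀ a ∈ A, ∀ b ∈ B, G.Adj a b) : Matchable G (A ∪ B) := by
  induction A using Finset.induction_on generalizing B with
  | empty =>
    obtain rfl : B = ∅ := by simpa using hc.symm
    exact .empty
  | @insert a A ha ih =>
    have hB : B.Nonempty := by
      rw [← card_pos, ← hc, card_insert_of_notMem ha]; omega
    obtain ⟨b, hb⟩ := hB
    rw [disjoint_insert_left] at hAB
    have := ih (B.erase b) (hAB.2.mono_right (erase_subset _ _))
      (by rw [card_erase_of_mem hb, ← hc, card_insert_of_notMem ha]; omega)
      (fun x hx y hy => hadj x (mem_insert_of_mem hx) y (mem_of_mem_erase hy))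
    have hbA : b ∉ A := fun h => disjoint_left.1 hAB.2 h hb
    have h2 := Matchable.insert (hadj a (mem_insert_self _ _) b hb)
      (by simp [ha, hAB.1]) (by simp [hbA]) this
    convert h2 using 1
    ext x
    simp only [mem_union, mem_insert, mem_erase]
    by_cases hx : x = b <;> simp [hx, hb, or_assoc]

theorem Matchable.card_eq_of_bipartite {S A B : Finset V} (hS : Matchable G S)
    (hAB : Disjoint A B) (hsub : S ⊆ A ∪ B)
    (hA : ∀ x ∈ A, ∀ y ∈ A, ¬ G.Adj x y) (hB : ∀ x ∈ B, ∀ y ∈ B, ¬ G.Adj x y) :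
    #(S ∩ A) = #(S ∩ B) := by
  induction hS with
  | empty => simp
  | @insert a b S hab ha hb _ ih =>
    simp only [insert_subset_iff, mem_union] at hsub
    have ih := ih hsub.2.2
    rw [disjoint_left] at hAB
    have hne := hab.ne
    rcases hsub.1 with h1 | h1 <;> rcases hsub.2.1 with h2 | h2
    · exact absurd hab (hA _ h1 _ h2)
    · rw [insert_inter_of_mem h1, insert_inter_of_notMem (fun h => hAB h h2),
        insert_inter_of_notMem (hAB h1), insert_inter_of_mem h2,
        card_insert_of_notMem (by simp [ha]), card_insert_of_notMem (by simp [hb]), ih]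
    · rw [insert_inter_of_notMem (fun h => hAB h h1), insert_inter_of_mem h2,
        insert_inter_of_mem h1, insert_inter_of_notMem (hAB h2),
        card_insert_of_notMem (by simp [hb]), card_insert_of_notMem (by simp [ha]), ih]
    · exact absurd hab (hB _ h1 _ h2)

end Matchable

/-! ### Equimatchable factor-critical graphs in terms of matchable sets -/

theorem isMaximalMatching_iff {V : Type*} {G : SimpleGraph V} {M : G.Subgraph} (hM : M.IsMatching) :
    IsMaximalMatching M ↔ ∀ x ∉ M.verts, ∀ y ∉ M.verts, ¬ G.Adj x y := by
  constructor
  · intro h x hx y hy hxy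
    have h2 := SimpleGraph.Subgraph.IsMatching.subgraphOfAdj hxy
    have h3 : (G.subgraphOfAdj hxy ⊔ M).IsMatching := by
      refine h2.sup hM ?_
      rw [h2.support_eq_verts, hM.support_eq_verts]
      simp [hx, hy]
    exact hx ((h.2 h3 le_sup_right).1 (by simp))
  · intro h
    refine ⟨hM, fun M' hM' hle => ?_⟩
    have hadj : ∀ v w, M'.Adj v w → M.Adj v w := by
      intro v w hvw
      by_cases hv : v ∈ M.verts
      · obtain ⟨u, hu, -⟩ := hM hv
        rwa [hM'.eq_of_adj_left hvw (hle.2 hu)]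
      · by_cases hw : w ∈ M.verts
        · obtain ⟨u, hu, -⟩ := hM hw
          rw [hM'.eq_of_adj_right hvw (hle.2 hu.symm)]
          exact hu.symm
        · exact absurd (M'.adj_sub hvw) (h v hv w hw)
    exact ⟨fun v hv => by
      obtain ⟨w, hw, -⟩ := hM' hv
      exact M.edge_vert (hadj _ _ hw), fun v w => hadj v w⟩

theorem two_mul_ncard_edgeSet {V : Type*} [Fintype V] {G : SimpleGraph V}
    {M : G.Subgraph} (hM : M.IsMatching) :
    2 * M.edgeSet.ncard = M.verts.ncard := by
  classical
  have h := M.spanningCoe.sum_degrees_eq_twice_card_edges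
  have h1 : M.edgeSet.ncard = #M.spanningCoe.edgeFinset := by
    rw [← Set.ncard_coe_finset, SimpleGraph.coe_edgeFinset,
      SimpleGraph.Subgraph.edgeSet_spanningCoe]
  rw [h1, ← h]
  have h2 : ∀ v, M.spanningCoe.degree v = if v ∈ M.verts then 1 else 0 := by
    intro v
    split_ifs with hv
    · rw [SimpleGraph.Subgraph.degree_spanningCoe]
      exact SimpleGraph.Subgraph.isMatching_iff_forall_degree.1 hM v hv
    · rw [SimpleGraph.Subgraph.degree_spanningCoe]
      exact SimpleGraph.Subgraph.degree_of_notMem_verts hv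
  simp only [h2, sum_ite, sum_const_zero, add_zero, sum_const, smul_eq_mul, mul_one]
  rw [← Set.ncard_coe_finset]
  simp

section EFC

variable {V : Type*} [Fintype V] [DecidableEq V] {G : SimpleGraph V}

/-- Whenever the vertices left uncovered by a matching are pairwise nonadjacent, there is at most
one of them. -/
def UncoversAtMostOne (G : SimpleGraph V) : Prop :=
  ∀ S : Finset V, Matchable G S → (∀ x ∉ S, ∀ y ∉ S, ¬ G.Adj x y) → #Sᶜ ≤ 1

theorem ncard_verts_add_card_compl (M : G.Subgraph) (S : Finset V) (h : M.verts = S) :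
    M.verts.ncard + #Sᶜ = Fintype.card V := by
  rw [h, Set.ncard_coe_finset, card_add_card_compl]

theorem UncoversAtMostOne.equimatchable (h : UncoversAtMostOne G) : Equimatchable G := by
  classical
  intro M hM
  refine ⟨hM.1, fun M' hM' => ?_⟩
  have h1 := two_mul_ncard_edgeSet hM.1
  have h2 := two_mul_ncard_edgeSet hM'
  have h3 := ncard_verts_add_card_compl M M.verts.toFinset (by simp)
  have h4 := ncard_verts_add_card_compl M' M'.verts.toFinset (by simp)
  have h5 := h M.verts.toFinset (matchable_verts_of_isMatching hM.1 _ (by simp))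
    (by simpa using (isMaximalMatching_iff hM.1).1 hM)
  omega

theorem uncoversAtMostOne_of_equimatchable [Nonempty V] (h : Equimatchable G)
    (hf : FactorCritical G) : UncoversAtMostOne G := by
  classical
  intro S hS hind
  obtain ⟨M, hM, hMS⟩ := exists_isMatching_of_matchable hS
  have hmax : IsMaximalMatching M := (isMaximalMatching_iff hM).2 (by simpa [hMS] using hind)
  obtain ⟨v⟩ := ‹Nonempty V›
  obtain ⟨N, hN, hN2⟩ := hf v
  have hN' := hN.map (SimpleGraph.Embedding.induce (G := G) ({v}ᶜ : Set V)).toHom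
    (SimpleGraph.Embedding.induce (G := G) ({v}ᶜ : Set V)).injective
  have hle := (h M hmax).2 _ hN'
  have h1 := two_mul_ncard_edgeSet hM
  have h2 := two_mul_ncard_edgeSet hN'
  have h3 := ncard_verts_add_card_compl M S hMS
  have h4 := ncard_verts_add_card_compl _ ({v}ᶜ : Finset V) (show
    (N.map (SimpleGraph.Embedding.induce (G := G) ({v}ᶜ : Set V)).toHom).verts = _ by
    rw [SimpleGraph.Subgraph.map_verts, hN2.verts_eq_univ, Set.image_univ]
    change Set.range Subtype.val = _
    ext x; simp)
  rw [compl_compl, card_singleton] at h4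
  omega

theorem factorCritical_of_matchable (h : ∀ v, Matchable G {v}ᶜ) : FactorCritical G := by
  intro v
  obtain ⟨M, hM, hv⟩ := exists_isMatching_of_matchable (h v)
  have hv' : ∀ x, x ∈ M.verts ↔ x ≠ v := by simp [hv]
  refine ⟨⟨Set.univ, fun x y => M.Adj x y, fun h => M.adj_sub h, fun _ => trivial,
    ⟨fun x y h => M.symm.symm _ _ h⟩⟩, ?_, fun _ => trivial⟩
  intro x _
  obtain ⟨w, hw, hu⟩ := hM ((hv' x).2 x.2)
  exact ⟨⟨w, (hv' w).1 (M.edge_vert hw.symm)⟩, hw, fun y hy => Subtype.ext (hu _ hy)⟩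

end EFC

/-! ### Induced odd cycles and bipartite complements -/

/-- `p` traverses an induced cycle of length `2 * k + 1` of `G` (for `1 ≤ k`). -/
structure IsCyc {V : Type*} (G : SimpleGraph V) (k : ℕ) (p : ZMod (2 * k + 1) → V) : Prop where
  inj : Function.Injective p
  adj_iff : ∀ i j, G.Adj (p i) (p j) ↔ j = i + 1 ∨ i = j + 1

theorem cycleGraph_adj_iff {k : ℕ} (hk : 1 ≤ k) (u v : ZMod (2 * k + 1)) :
    (SimpleGraph.cycleGraph (2 * k + 1)).Adj u v ↔ v = u + 1 ∨ u = v + 1 := by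
  obtain ⟨k, rfl⟩ : ∃ l, k = l + 1 := ⟨k - 1, by omega⟩
  have : (SimpleGraph.cycleGraph (2 * (k + 1) + 1)).Adj u v ↔ u - v = 1 ∨ v - u = 1 :=
    SimpleGraph.cycleGraph_adj (n := 2 * k + 1)
  rw [this, sub_eq_iff_eq_add', sub_eq_iff_eq_add', or_comm]

theorem isInducedOddCycle_iff {V : Type*} {G : SimpleGraph V} {C : Set V} :
    IsInducedOddCycle G C ↔ ∃ k, 1 ≤ k ∧ ∃ p, IsCyc G k p ∧ Set.range p = C := by
  constructor
  · rintro ⟨k, hk, ⟨e⟩⟩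
    refine ⟨k, hk, fun i => (e.symm i).1, ⟨?_, ?_⟩, ?_⟩
    · exact fun i j h => e.symm.injective (Subtype.ext h)
    · intro i j
      rw [← cycleGraph_adj_iff hk]
      exact e.symm.map_adj_iff
    · ext x
      constructor
      · rintro ⟨i, rfl⟩
        exact (e.symm i).2
      · exact fun hx => ⟨e ⟨x, hx⟩, by simp⟩
  · rintro ⟨k, hk, p, hp, rfl⟩
    refine ⟨k, hk, ⟨SimpleGraph.Iso.symm ⟨Equiv.ofInjective p hp.inj, ?_⟩⟩⟩
    intro i j
    exact (hp.adj_iff i j).trans (cycleGraph_adj_iff hk i j).symm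

theorem natCast_inj_of_lt {n i j : ℕ} (hi : i < n) (hj : j < n) :
    (i : ZMod n) = j ↔ i = j := by
  rw [ZMod.natCast_eq_natCast_iff', Nat.mod_eq_of_lt hi, Nat.mod_eq_of_lt hj]

theorem natCast_two_mul_add_one (k : ℕ) : ((2 * k : ℕ) : ZMod (2 * k + 1)) + 1 = 0 := by
  exact_mod_cast ZMod.natCast_self (2 * k + 1)

/-- Every element of `ZMod n` is reached from `c` in fewer than `n` steps. -/
theorem exists_natCast_add {n : ℕ} [NeZero n] (c i : ZMod n) : ∃ m < n, i = c + (m : ZMod n) :=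
  ⟨(i - c).val, ZMod.val_lt _, by simp⟩

theorem IsCyc.rotate {V : Type*} {G : SimpleGraph V} {k : ℕ} {p : ZMod (2 * k + 1) → V}
    (h : IsCyc G k p) (c : ZMod (2 * k + 1)) : IsCyc G k (fun i => p (c + i)) := by
  refine ⟨fun i j hij => by simpa using h.inj hij, fun i j => ?_⟩
  simp [h.adj_iff, add_assoc]

theorem IsCyc.reflect {V : Type*} {G : SimpleGraph V} {k : ℕ} {p : ZMod (2 * k + 1) → V}
    (h : IsCyc G k p) (c : ZMod (2 * k + 1)) : IsCyc G k (fun i => p (c - i)) := by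
  refine ⟨fun i j hij => by simpa using h.inj hij, fun i j => ?_⟩
  rw [h.adj_iff]
  constructor
  · rintro (h | h)
    · right; linear_combination h
    · left; linear_combination h
  · rintro (h | h)
    · right; linear_combination h
    · left; linear_combination h

/-- Adjacency along an induced cycle that is unrolled from the base point `c`. -/
theorem IsCyc.adj_natCast_iff {V : Type*} {G : SimpleGraph V} {k : ℕ} {p : ZMod (2 * k + 1) → V}
    (h : IsCyc G k p) (c : ZMod (2 * k + 1)) {i j : ℕ} (hij : i < j) (hj : j ≤ 2 * k) :
    G.Adj (p (c + i)) (p (c + j)) ↔ j = i + 1 ∨ i = 0 ∧ j = 2 * k := by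
  rw [h.adj_iff, add_assoc, add_assoc, add_right_inj, add_right_inj]
  have h1 : (j : ZMod (2 * k + 1)) = i + 1 ↔ j = i + 1 := by
    rw [← natCast_inj_of_lt (n := 2 * k + 1) (i := j) (j := i + 1) (by omega) (by omega)]
    push_cast; rfl
  have h2 : (i : ZMod (2 * k + 1)) = j + 1 ↔ i = 0 ∧ j = 2 * k := by
    constructor
    · intro h
      obtain hj | rfl := hj.lt_or_eq
      · have := (natCast_inj_of_lt (n := 2 * k + 1) (i := i) (j := j + 1) (by omega)
          (by omega)).1 (by push_cast; exact h)
        omega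
      · rw [natCast_two_mul_add_one] at h
        exact ⟨(natCast_inj_of_lt (n := 2 * k + 1) (i := i) (j := 0) (by omega) (by omega)).1
          (by simpa using h), rfl⟩
    · rintro ⟨rfl, rfl⟩
      rw [natCast_two_mul_add_one]
      simp
  rw [h1, h2]

theorem IsCyc.natCast_inj {V : Type*} {G : SimpleGraph V} {k : ℕ} {p : ZMod (2 * k + 1) → V}
    (h : IsCyc G k p) (c : ZMod (2 * k + 1)) {i j : ℕ} (hi : i ≤ 2 * k) (hj : j ≤ 2 * k) :
    p (c + i) = p (c + j) ↔ i = j := by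
  rw [h.inj.eq_iff, add_right_inj, natCast_inj_of_lt (by omega) (by omega)]

theorem Matchable.image {ι V : Type*} [DecidableEq ι] [DecidableEq V] {H : SimpleGraph ι}
    {G : SimpleGraph V} {S : Finset ι} (hS : Matchable H S) (f : ι → V)
    (hinj : Set.InjOn f S) (hadj : ∀ i ∈ S, ∀ j ∈ S, H.Adj i j → G.Adj (f i) (f j)) :
    Matchable G (S.image f) := by
  induction hS with
  | empty => simpa using Matchable.empty
  | @insert a b S hab ha hb _ ih =>
    rw [image_insert, image_insert]
    refine .insert (hadj a (by simp) b (by simp) hab) ?_ ?_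
      (ih (hinj.mono fun x hx => by simp_all) fun i hi j hj =>
        hadj i (by simp [hi]) j (by simp [hj]))
    · intro h
      obtain ⟨x, hx, hxa⟩ := mem_image.1 h
      rw [hinj (by simp [hx]) (by simp) hxa] at hx
      exact ha hx
    · intro h
      obtain ⟨x, hx, hxa⟩ := mem_image.1 h
      rw [hinj (by simp [hx]) (by simp) hxa] at hx
      exact hb hx

theorem matchable_hasse_Ioc (s m : ℕ) : Matchable (SimpleGraph.hasse ℕ) (Ioc s (s + 2 * m)) := by
  induction m with
  | zero => simpa using Matchable.empty
  | succ m ih =>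
    have := Matchable.insert (G := SimpleGraph.hasse ℕ) (a := s + 2 * m + 1) (b := s + 2 * m + 2)
      (by simp [SimpleGraph.hasse_adj, Nat.covBy_iff_add_one_eq]) (by simp) (by simp) ih
    convert this using 1
    ext x
    simp only [mem_Ioc, mem_insert]
    omega

section

variable {V : Type*} [DecidableEq V] {G : SimpleGraph V} {k : ℕ} {p : ZMod (2 * k + 1) → V}

theorem IsCyc.matchable_image (h : IsCyc G k p) (c : ZMod (2 * k + 1)) {I : Finset ℕ}
    (hI : I ⊆ Ioc 0 (2 * k)) (hm : Matchable (SimpleGraph.hasse ℕ) I) :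
    Matchable G (I.image fun i : ℕ => p (c + i)) := by
  have hI' : ∀ i ∈ I, i ≤ 2 * k := fun i hi => (mem_Ioc.1 (hI hi)).2
  refine hm.image _ (fun i hi j hj hij => (h.natCast_inj c (hI' i hi) (hI' j hj)).1 hij) ?_
  intro i hi j hj hij
  simp only [SimpleGraph.hasse_adj, Nat.covBy_iff_add_one_eq] at hij
  rcases hij with rfl | rfl
  · exact (h.adj_natCast_iff c (by omega) (hI' _ hj)).2 (.inl rfl)
  · exact ((h.adj_natCast_iff c (by omega) (hI' _ hi)).2 (.inl rfl)).symm

theorem IsCyc.matchable_erase (h : IsCyc G k p) (c : ZMod (2 * k + 1)) :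
    Matchable G ((univ.image p).erase (p c)) := by
  have := h.matchable_image c (I := Ioc 0 (0 + 2 * k)) (by simp) (matchable_hasse_Ioc 0 k)
  convert this using 1
  ext x
  simp only [mem_erase, mem_image, mem_univ, true_and, mem_Ioc]
  constructor
  · rintro ⟨hx, i, rfl⟩
    obtain ⟨m, hm, rfl⟩ := exists_natCast_add c i
    exact ⟨m, ⟨Nat.pos_of_ne_zero fun h0 => hx (by simp [h0]), by omega⟩, rfl⟩
  · rintro ⟨m, hm, rfl⟩
    refine ⟨fun h0 => ?_, _, rfl⟩
    have := (h.natCast_inj c (i := m) (j := 0) (by omega) (by omega)).1 (by simpa using h0)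
    omega

end

/-- The vertices of `G` off the induced odd cycle `p` form a balanced complete bipartite graph
with parts `A` and `B`. -/
structure IsDecomp {V : Type*} (G : SimpleGraph V) (k : ℕ) (p : ZMod (2 * k + 1) → V)
    (A B : Finset V) : Prop where
  cyc : IsCyc G k p
  disj : Disjoint A B
  notMem_left : ∀ i, p i ∉ A
  notMem_right : ∀ i, p i ∉ B
  cover : ∀ v, (∃ i, p i = v) ∨ v ∈ A ∨ v ∈ B
  card_eq : #A = #B
  nonempty : A.Nonempty
  adj : ∀ a ∈ A, ∀ b ∈ B, G.Adj a b
  indep_left : ∀ a ∈ A, ∀ b ∈ A, ¬ G.Adj a b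
  indep_right : ∀ a ∈ B, ∀ b ∈ B, ¬ G.Adj a b

section

variable {V : Type*} {G : SimpleGraph V} {k : ℕ} {p : ZMod (2 * k + 1) → V} {A B : Finset V}

theorem IsDecomp.symm (h : IsDecomp G k p A B) : IsDecomp G k p B A where
  cyc := h.cyc
  disj := h.disj.symm
  notMem_left := h.notMem_right
  notMem_right := h.notMem_left
  cover v := (h.cover v).imp id Or.symm
  card_eq := h.card_eq.symm
  nonempty := by rw [← card_pos, ← h.card_eq, card_pos]; exact h.nonempty
  adj a ha b hb := (h.adj b hb a ha).symm
  indep_left := h.indep_right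
  indep_right := h.indep_left

theorem IsDecomp.rotate (h : IsDecomp G k p A B) (c : ZMod (2 * k + 1)) :
    IsDecomp G k (fun i => p (c + i)) A B where
  cyc := h.cyc.rotate c
  disj := h.disj
  notMem_left _ := h.notMem_left _
  notMem_right _ := h.notMem_right _
  cover v := (h.cover v).imp (fun ⟨i, hi⟩ => ⟨i - c, by simpa using hi⟩) id
  card_eq := h.card_eq
  nonempty := h.nonempty
  adj := h.adj
  indep_left := h.indep_left
  indep_right := h.indep_right

theorem IsDecomp.reflect (h : IsDecomp G k p A B) (c : ZMod (2 * k + 1)) :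
    IsDecomp G k (fun i => p (c - i)) A B where
  cyc := h.cyc.reflect c
  disj := h.disj
  notMem_left _ := h.notMem_left _
  notMem_right _ := h.notMem_right _
  cover v := (h.cover v).imp (fun ⟨i, hi⟩ => ⟨c - i, by simpa using hi⟩) id
  card_eq := h.card_eq
  nonempty := h.nonempty
  adj := h.adj
  indep_left := h.indep_left
  indep_right := h.indep_right

end

section

variable {V : Type*} [Fintype V] [DecidableEq V] {G : SimpleGraph V} {k : ℕ}
  {p : ZMod (2 * k + 1) → V} {A B : Finset V}

/-- Match an edge from the cycle to `A`, and leave uncovered one vertex `b` of `B` and two vertices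
of the remaining path, at positions of opposite parity. They cannot be independent, so `b` sees one
of the two. -/
theorem IsDecomp.adj_or_adj (h : IsDecomp G k p A B) (hE : UncoversAtMostOne G) {a b : V}
    (ha : a ∈ A) (hb : b ∈ B) {c : ZMod (2 * k + 1)} (hca : G.Adj (p c) a) (s t : ℕ) (hst : s < t)
    (htk : 2 * t + 2 ≤ 2 * k) :
    G.Adj b (p (c + (2 * s + 1 : ℕ))) ∨ G.Adj b (p (c + (2 * t + 2 : ℕ))) := by
  by_contra hcon
  rw [not_or] at hcon
  -- positions along `C - c` of the vertices to be matched within the path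
  set I : Finset ℕ := Ioc 0 (0 + 2 * s) ∪ (Ioc (2 * s + 1) (2 * s + 1 + 2 * (t - s)) ∪
    Ioc (2 * t + 2) (2 * t + 2 + 2 * (k - t - 1))) with hI
  have hmem : ∀ n, n ∈ I ↔ 0 < n ∧ n ≤ 2 * k ∧ n ≠ 2 * s + 1 ∧ n ≠ 2 * t + 2 := by
    intro n
    simp only [hI, mem_union, mem_Ioc]
    omega
  have hIm : Matchable (SimpleGraph.hasse ℕ) I := by
    refine (matchable_hasse_Ioc _ _).union ((matchable_hasse_Ioc _ _).union
      (matchable_hasse_Ioc _ _) ?_) ?_ <;> rw [disjoint_left] <;>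
      simp only [mem_union, mem_Ioc] <;> omega
  have h1 := h.cyc.matchable_image c (I := I)
    (fun n hn => mem_Ioc.2 ⟨((hmem n).1 hn).1, ((hmem n).1 hn).2.1⟩) hIm
  have h2 : Matchable G (A.erase a ∪ B.erase b) :=
    matchable_of_complete_bipartite _ _
      (h.disj.mono (erase_subset _ _) (erase_subset _ _))
      (by rw [card_erase_of_mem ha, card_erase_of_mem hb, h.card_eq])
      (fun x hx y hy => h.adj x (mem_of_mem_erase hx) y (mem_of_mem_erase hy))
  have h3 := h1.union h2 (by
    rw [disjoint_left]
    intro x hx hx2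
    obtain ⟨i, -, rfl⟩ := mem_image.1 hx
    rcases mem_union.1 hx2 with h' | h'
    · exact h.notMem_left _ (mem_of_mem_erase h')
    · exact h.notMem_right _ (mem_of_mem_erase h'))
  have hpc : ∀ i : ℕ, i ≤ 2 * k → i ∉ I → p (c + i) ∉
      (I.image fun i : ℕ => p (c + i)) ∪ (A.erase a ∪ B.erase b) := by
    intro i hi hiI hmem'
    simp only [mem_union, mem_image, mem_erase] at hmem'
    rcases hmem' with ⟨j, hj, hij⟩ | hA | hB
    · rw [h.cyc.natCast_inj c ((hmem j).1 hj).2.1 hi] at hij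
      exact hiI (hij ▸ hj)
    · exact h.notMem_left _ hA.2
    · exact h.notMem_right _ hB.2
  have haB : a ∉ B := disjoint_left.1 h.disj ha
  have h4 := Matchable.insert hca (by simpa using hpc 0 (by omega) (by simp [hmem]))
    (by
      simp only [mem_union, mem_image, mem_erase, not_or]
      refine ⟨?_, by simp, by simp [haB]⟩
      rintro ⟨j, -, rfl⟩
      exact h.notMem_left _ ha) h3
  set S := insert (p c) (insert a ((I.image fun i : ℕ => p (c + i)) ∪ (A.erase a ∪ B.erase b)))
    with hS
  have hout : ∀ x ∉ S, x = b ∨ x = p (c + (2 * s + 1 : ℕ)) ∨ x = p (c + (2 * t + 2 : ℕ)) := by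
    intro x hx
    simp only [hS, mem_insert, mem_union, mem_image, mem_erase, not_or, hmem] at hx
    rcases h.cover x with ⟨i, rfl⟩ | hA | hB
    · obtain ⟨m, hm, rfl⟩ := exists_natCast_add c i
      right
      by_contra hne
      rw [not_or] at hne
      refine hx.2.2.1 ⟨m, ⟨Nat.pos_of_ne_zero ?_, by omega, ?_, ?_⟩, rfl⟩
      · rintro rfl
        exact hx.1 (by simp)
      · rintro rfl
        exact hne.1 rfl
      · rintro rfl
        exact hne.2 rfl
    · exact absurd ⟨hx.2.1, hA⟩ hx.2.2.2.1
    · left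
      by_contra hne
      exact hx.2.2.2.2 ⟨hne, hB⟩
  have hnadj : ¬ G.Adj (p (c + (2 * s + 1 : ℕ))) (p (c + (2 * t + 2 : ℕ))) := by
    rw [h.cyc.adj_natCast_iff c (by omega) htk]
    omega
  have hle := hE S h4 (by
    intro x hx y hy hxy
    rcases hout x hx with rfl | rfl | rfl <;> rcases hout y hy with rfl | rfl | rfl
    · exact hxy.ne rfl
    · exact hcon.1 hxy
    · exact hcon.2 hxy
    · exact hcon.1 hxy.symm
    · exact hxy.ne rfl
    · exact hnadj hxy
    · exact hcon.2 hxy.symm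
    · exact hnadj hxy.symm
    · exact hxy.ne rfl)
  have hp : ∀ i : ℕ, 0 < i → i ≤ 2 * k → i ∉ I → p (c + i) ∈ Sᶜ := by
    intro i hi0 hi hiI
    rw [mem_compl, hS, mem_insert, mem_insert, not_or, not_or]
    refine ⟨fun h0 => ?_, ?_, hpc i hi hiI⟩
    · have := (h.cyc.natCast_inj c hi (j := 0) (by omega)).1 (by simpa using h0)
      omega
    · rintro rfl
      exact h.notMem_left _ ha
  have := card_le_one.1 hle _ (hp (2 * s + 1) (by omega) (by omega) (by simp [hmem]))
    _ (hp (2 * t + 2) (by omega) (by omega) (by simp [hmem]))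
  rw [h.cyc.natCast_inj c (by omega) (by omega)] at this
  omega

end

/-! ### The complement of the cycle is a balanced complete bipartite graph -/

/-- An invariant that holds at one vertex of a connected induced subgraph and propagates along its
edges holds everywhere on it. -/
theorem forall_of_connected_induce {V : Type*} {G : SimpleGraph V} {S : Set V}
    (hS : (G.induce S).Connected) (P : V → Prop) {s : V} (hs : s ∈ S) (h0 : P s)
    (hstep : ∀ x ∈ S, ∀ y ∈ S, P x → G.Adj x y → P y) : ∀ v ∈ S, P v := by
  intro v hv
  obtain ⟨w⟩ := hS.preconnected ⟨s, hs⟩ ⟨v, hv⟩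
  have : ∀ (x y : S) (w : (G.induce S).Walk x y), P x → P y := by
    intro x y w
    induction w with
    | nil => exact id
    | cons h _ ih => exact fun hx => ih (hstep _ (Subtype.prop _) _ (Subtype.prop _) hx h)
  exact this _ _ w h0

theorem connected_induce_of_forall {V : Type*} {G : SimpleGraph V} {S : Set V} {s : V}
    (hs : s ∈ S) (h : ∀ P : V → Prop, P s → (∀ x ∈ S, ∀ y ∈ S, P x → G.Adj x y → P y) →
      ∀ v ∈ S, P v) : (G.induce S).Connected := by
  have hr := h (fun v => ∃ hv : v ∈ S, (G.induce S).Reachable ⟨s, hs⟩ ⟨v, hv⟩)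
    ⟨hs, .rfl⟩ (by
      rintro x hx y hy ⟨hx', hr⟩ hxy
      refine ⟨hy, hr.trans (SimpleGraph.Adj.reachable ?_)⟩
      exact hxy)
  have : Nonempty S := ⟨⟨s, hs⟩⟩
  refine ⟨fun x y => ?_⟩
  obtain ⟨_, hx⟩ := hr x x.2
  obtain ⟨_, hy⟩ := hr y y.2
  exact hx.symm.trans hy

theorem not_adj_of_cliqueFree {V : Type*} {G : SimpleGraph V} (hG : G.CliqueFree 3) {a b c : V}
    (hab : G.Adj a b) (hbc : G.Adj b c) : ¬ G.Adj a c := by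
  classical
  intro hac
  exact hG {a, b, c} (SimpleGraph.is3Clique_triple_iff.2 ⟨hab, hac, hbc⟩)

section

variable {V : Type*} {G : SimpleGraph V} {k : ℕ} {p : ZMod (2 * k + 1) → V}

/-- Two vertices of a triangle-free graph do not dominate an odd cycle: their neighbourhoods would
colour it properly with two colours. -/
theorem IsCyc.exists_not_adj (hp : IsCyc G k p) (hG : G.CliqueFree 3) (u u' : V) :
    ∃ c, ¬ G.Adj (p c) u ∧ ¬ G.Adj (p c) u' := by
  by_contra! hcon
  have hstep : ∀ c, G.Adj (p (c + 1)) u ↔ ¬ G.Adj (p c) u := by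
    intro c
    have hc : G.Adj (p c) (p (c + 1)) := (hp.adj_iff _ _).2 (.inl rfl)
    constructor
    · exact fun h1 => not_adj_of_cliqueFree hG hc h1
    · intro h1
      by_contra h2
      exact not_adj_of_cliqueFree hG hc (hcon _ h2) (hcon _ h1)
  have hn : ∀ n : ℕ, G.Adj (p (n : ZMod (2 * k + 1))) u ↔ (G.Adj (p 0) u ↔ Even n) := by
    intro n
    induction n with
    | zero => simp
    | succ n ih =>
      push_cast
      rw [hstep, ih, Nat.even_add_one]
      tauto
  have h1 := hn (2 * k + 1)
  rw [ZMod.natCast_self] at h1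
  have h2 : ¬ Even (2 * k + 1) := by simp
  tauto

variable [Fintype V] [DecidableEq V]

/-- The complement `D` of the cycle is randomly matchable: its maximal matchings are perfect. -/
theorem IsCyc.eq_of_isolating (hp : IsCyc G k p) (hG : G.CliqueFree 3) (hE : UncoversAtMostOne G)
    {D S : Finset V} (hD : D = (univ.image p)ᶜ) (hS : Matchable G S) (hSD : S ⊆ D)
    (hind : ∀ x ∈ D \ S, ∀ y ∈ D \ S, ¬ G.Adj x y) : S = D := by
  by_contra hne
  obtain ⟨u₀, hu₀⟩ : (D \ S).Nonempty := by
    rw [sdiff_nonempty]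
    exact fun h => hne (hSD.antisymm h)
  have hpD : ∀ i, p i ∉ D := by simp [hD]
  have hdis : ∀ c, Disjoint S ((univ.image p).erase (p c)) := by
    intro c
    rw [disjoint_left]
    intro x hx hx2
    obtain ⟨i, -, rfl⟩ := mem_image.1 (mem_of_mem_erase hx2)
    exact hpD i (hSD hx)
  have hM : ∀ c, Matchable G (S ∪ (univ.image p).erase (p c)) := fun c =>
    hS.union (hp.matchable_erase c) (hdis c)
  have hmem : ∀ c x, x ∉ S ∪ (univ.image p).erase (p c) ↔ x = p c ∨ x ∈ D \ S := by
    intro c x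
    simp only [hD, mem_union, mem_erase, mem_image, mem_univ, true_and, mem_sdiff, mem_compl]
    have : p c ∉ S := fun h => hpD c (hSD h)
    have h2 : (∃ a, p a = x) → x ∉ S := by
      rintro ⟨a, rfl⟩ h
      exact hpD a (hSD h)
    by_cases hx : x = p c
    · subst hx; simp [this]
    · simp only [hx, false_or]; tauto
  have hdom : ∀ c, ∃ u ∈ D \ S, G.Adj (p c) u := by
    intro c
    by_contra! hcon
    have hle := hE _ (hM c) (by
      intro x hx y hy hxy
      rw [hmem] at hx hy
      rcases hx with rfl | hx <;> rcases hy with rfl | hy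
      · exact hxy.ne rfl
      · exact hcon _ hy hxy
      · exact hcon _ hx hxy.symm
      · exact hind _ hx _ hy hxy)
    have := card_le_one.1 hle (p c) (by rw [mem_compl, hmem]; simp) u₀
      (by rw [mem_compl, hmem]; exact .inr hu₀)
    exact hpD c (this ▸ (mem_sdiff.1 hu₀).1)
  obtain ⟨u, hu, hu2⟩ := hdom 0
  have hle := hE _ (.insert hu2 ((hmem _ _).2 (.inl rfl)) ((hmem _ _).2 (.inr hu)) (hM 0)) (by
    intro x hx y hy hxy
    rw [mem_insert, mem_insert, not_or, not_or, hmem] at hx hy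
    exact hind _ (hx.2.2.resolve_left hx.1) _ (hy.2.2.resolve_left hy.1) hxy)
  obtain ⟨u', hu'⟩ : ∃ u', ∀ x ∈ D \ S, x = u ∨ x = u' := by
    by_cases h : ∃ u' ∈ D \ S, u' ≠ u
    · obtain ⟨u', h1, h2⟩ := h
      refine ⟨u', fun x hx => or_iff_not_imp_left.2 fun hxu => ?_⟩
      have hout : ∀ z ∈ D \ S, z ≠ u →
          z ∈ (insert (p 0) (insert u (S ∪ (univ.image p).erase (p 0))))ᶜ := by
        intro z hz hzu
        rw [mem_compl, mem_insert, mem_insert, not_or, not_or, hmem]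
        exact ⟨fun h => hpD 0 (h ▸ (mem_sdiff.1 hz).1), hzu, .inr hz⟩
      exact card_le_one.1 hle _ (hout x hx hxu) _ (hout u' h1 h2)
    · push Not at h
      exact ⟨u, fun x hx => .inl (h x hx)⟩
  obtain ⟨c, hc, hc'⟩ := hp.exists_not_adj hG u u'
  obtain ⟨v, hv, hcv⟩ := hdom c
  rcases hu' v hv with rfl | rfl
  · exact hc hcv
  · exact hc' hcv

/-- Replacing the end edges of a path `w x y z` by its middle edge in a perfect matching of `D`
leaves `w` and `z` uncovered, so that they are adjacent. -/
theorem IsCyc.adj_of_path (hp : IsCyc G k p) (hG : G.CliqueFree 3) (hE : UncoversAtMostOne G)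
    {D : Finset V} (hD : D = (univ.image p)ᶜ) {w x y z : V} (hw : w ∈ D) (hx : x ∈ D) (hy : y ∈ D)
    (hz : z ∈ D) (hwx : G.Adj w x) (hxy : G.Adj x y) (hyz : G.Adj y z) (hwy : w ≠ y)
    (hwz : w ≠ z) (hxz : x ≠ z) : G.Adj w z := by
  by_contra hcon
  obtain ⟨T, hTD, hT, hind⟩ := exists_matchable_subset_isolating G (D \ {w, x, y, z})
  have hT' : ∀ v ∈ T, v ∈ D ∧ v ≠ w ∧ v ≠ x ∧ v ≠ y ∧ v ≠ z := by
    intro v hv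
    simpa using hTD hv
  have hn : w ∉ T ∧ x ∉ T ∧ y ∉ T ∧ z ∉ T :=
    ⟨fun h => by simpa using hT' _ h, fun h => by simpa using hT' _ h,
      fun h => by simpa using hT' _ h, fun h => by simpa using hT' _ h⟩
  have h1 := hp.eq_of_isolating hG hE hD
    (.insert hwx (by simp [hwy, hwz, hn]) (by simp [hxy.ne, hxz, hn])
      (.insert hyz hn.2.2.1 hn.2.2.2 hT))
    (by
      simp only [insert_subset_iff, hw, hx, hy, hz, true_and]
      exact fun v hv => (hT' v hv).1)
    (by
      intro a ha b hb
      apply hind <;> simp_all)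
  have h2 := hp.eq_of_isolating hG hE hD (.insert hxy hn.2.1 hn.2.2.1 hT)
    (by
      simp only [insert_subset_iff, hx, hy, true_and]
      exact fun v hv => (hT' v hv).1)
    (by
      have : ∀ a ∈ D \ insert x (insert y T), a = w ∨ a = z := by
        intro a ha
        rw [← h1] at ha
        simp only [mem_sdiff, mem_insert] at ha
        tauto
      intro a ha b hb hab
      rcases this a ha with rfl | rfl <;> rcases this b hb with rfl | rfl
      · exact hab.ne rfl
      · exact hcon hab
      · exact hcon hab.symm
      · exact hab.ne rfl)
  rw [← h2] at hw
  simp [hwx.ne, hwy, hn.1] at hw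

theorem IsCyc.exists_isDecomp (hp : IsCyc G k p) (hG : G.CliqueFree 3) (hE : UncoversAtMostOne G)
    (hconn : (G.induce (Set.range p)ᶜ).Connected) : ∃ A B, IsDecomp G k p A B := by
  classical
  obtain ⟨D, hD⟩ : ∃ D, D = (univ.image p)ᶜ := ⟨_, rfl⟩
  have hDmem : ∀ v, v ∈ (Set.range p)ᶜ ↔ v ∈ D := by simp [hD]
  obtain ⟨⟨v₀, hv₀'⟩⟩ := hconn.nonempty
  have hv₀ := (hDmem _).1 hv₀'
  have hpath := @IsCyc.adj_of_path _ _ _ _ _ _ hp hG hE D hD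
  -- the vertices at distance at most two from `v₀` are closed under adjacency in `D`
  have hP := forall_of_connected_induce hconn
    (fun v => v = v₀ ∨ G.Adj v₀ v ∨ ∃ b ∈ D, G.Adj v₀ b ∧ G.Adj b v) hv₀' (.inl rfl) (by
      rintro x hx y hy hPx hxy
      rw [hDmem] at hx hy
      rcases hPx with rfl | hx1 | ⟨b, hb, h1, h2⟩
      · exact .inr (.inl hxy)
      · exact .inr (.inr ⟨x, hx, hx1, hxy⟩)
      · by_cases hy1 : y = v₀
        · exact .inl hy1
        by_cases hy2 : y = b
        · exact .inr (.inl (hy2 ▸ h1))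
        by_cases hx0 : x = v₀
        · exact .inr (.inl (hx0 ▸ hxy))
        exact .inr (.inl (hpath hv₀ hb hx hy h1 h2 hxy (Ne.symm hx0) (Ne.symm hy1) (Ne.symm hy2))))
  set A := D.filter fun v => ¬ G.Adj v₀ v with hA
  set B := D.filter fun v => G.Adj v₀ v with hB
  have hadj : ∀ a ∈ A, ∀ b ∈ B, G.Adj a b := by
    intro a ha b hb
    simp only [hA, hB, mem_filter] at ha hb
    rcases hP a ((hDmem _).2 ha.1) with rfl | h | ⟨b', hb', h1, h2⟩
    · exact hb.2
    · exact absurd h ha.2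
    · by_cases hbb : b' = b
      · exact hbb ▸ h2.symm
      by_cases hav : a = v₀
      · exact hav ▸ hb.2
      exact hpath ha.1 hb' hv₀ hb.1 h2.symm h1.symm hb.2 hav (fun h => ha.2 (h ▸ hb.2)) hbb
  have hindB : ∀ a ∈ B, ∀ b ∈ B, ¬ G.Adj a b := by
    intro a ha b hb hab
    simp only [hB, mem_filter] at ha hb
    exact not_adj_of_cliqueFree hG ha.2 hab hb.2
  have hindA : ∀ a ∈ A, ∀ b ∈ A, ¬ G.Adj a b := by
    intro a ha b hb hab
    have ha' := mem_filter.1 ha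
    rcases hP a ((hDmem _).2 ha'.1) with rfl | h | ⟨c, hc, h1, h2⟩
    · exact (mem_filter.1 hb).2 hab
    · exact ha'.2 h
    · exact not_adj_of_cliqueFree hG hab (hadj b hb c (mem_filter.2 ⟨hc, h1⟩)) h2.symm
  have hdisj : Disjoint A B := by
    rw [disjoint_left]
    intro x hx hx2
    exact (mem_filter.1 hx).2 (mem_filter.1 hx2).2
  have hcov : ∀ v ∈ D, v ∈ A ∨ v ∈ B := by
    intro v hv
    simp only [hA, hB, mem_filter, hv, true_and]
    tauto
  refine ⟨A, B, hp, hdisj, ?_, ?_, ?_, ?_, ⟨v₀, by simp [hA, hv₀]⟩, hadj, hindA, hindB⟩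
  · intro i hi
    simp [hA, hD] at hi
  · intro i hi
    simp [hB, hD] at hi
  · intro v
    by_cases hv : v ∈ D
    · exact .inr (hcov v hv)
    · left
      simpa [hD] using hv
  · obtain ⟨T, hTD, hT, hind⟩ := exists_matchable_subset_isolating G D
    obtain rfl := hp.eq_of_isolating hG hE hD hT hTD hind
    have h := hT.card_eq_of_bipartite hdisj
      (fun v hv => mem_union.2 (hcov v hv)) hindA hindB
    rwa [inter_eq_right.2 (filter_subset _ _), inter_eq_right.2 (filter_subset _ _)] at h

end

/-! ### Shortening the cycle -/

section

variable {V : Type*} {G : SimpleGraph V} {k : ℕ} {p : ZMod (2 * k + 1) → V}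

/-- An induced cycle given by its vertices `q 0, …, q (2 * k)`. -/
theorem isCyc_of_nat (hk : 1 ≤ k) (q : ℕ → V) (hinj : ∀ i j, i < j → j ≤ 2 * k → q i ≠ q j)
    (hadj : ∀ i j, i < j → j ≤ 2 * k → (G.Adj (q i) (q j) ↔ j = i + 1 ∨ i = 0 ∧ j = 2 * k)) :
    IsCyc G k (fun i : ZMod (2 * k + 1) => q i.val) := by
  have key : ∀ i j : ZMod (2 * k + 1), i.val < j.val →
      ((j = i + 1 ∨ i = j + 1) ↔ j.val = i.val + 1 ∨ i.val = 0 ∧ j.val = 2 * k) := by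
    intro i j hij
    have hj := j.val_lt
    have hs : ∀ a : ZMod (2 * k + 1), (a + 1).val = if a.val = 2 * k then 0 else a.val + 1 := by
      intro a
      have ha := a.val_lt
      split_ifs with h
      · rw [← a.natCast_zmod_val, h, natCast_two_mul_add_one, ZMod.val_zero]
      · conv_lhs => rw [← a.natCast_zmod_val]
        rw [← Nat.cast_succ, ZMod.val_natCast_of_lt (by omega)]
    rw [← (ZMod.val_injective _).eq_iff, ← (ZMod.val_injective _).eq_iff (a := i), hs, hs]
    split_ifs <;> omega
  refine ⟨fun i j hij => ?_, fun i j => ?_⟩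
  · by_contra hne
    have hne' : i.val ≠ j.val := fun h => hne (ZMod.val_injective _ h)
    have hi := i.val_lt
    have hj := j.val_lt
    rcases Nat.lt_or_gt_of_ne hne' with h | h
    · exact hinj _ _ h (by omega) hij
    · exact hinj _ _ h (by omega) hij.symm
  · have hi := i.val_lt
    have hj := j.val_lt
    rcases lt_trichotomy i.val j.val with h | h | h
    · rw [hadj _ _ h (by omega), key i j h]
    · rw [ZMod.val_injective _ h]
      simp only [SimpleGraph.irrefl, or_self, false_iff]
      intro h1
      rw [left_eq_add] at h1
      have h2 := (natCast_inj_of_lt (n := 2 * k + 1) (i := 1) (j := 0) (by omega) (by omega)).1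
        (by simpa using h1)
      omega
    · rw [SimpleGraph.adj_comm, hadj _ _ h (by omega), ← key j i h, or_comm]

/-- A vertex `b` off the cycle with three neighbours on it yields a shorter induced odd cycle: two
neighbours of `b` at minimal odd distance `g` along the cycle close up with `b`, and the other arc
contains a third neighbour of `b`, next to which every vertex of `A` has a neighbour. -/
theorem IsDecomp.exists_shorter [Fintype V] [DecidableEq V] {A B : Finset V}
    (h : IsDecomp G k p A B) (hk : 2 ≤ k) (hG : G.CliqueFree 3) (hE : UncoversAtMostOne G) {b : V}
    (hb : b ∈ B) {x₁ x₂ x₃ : ZMod (2 * k + 1)} (h₁ : G.Adj b (p x₁)) (h₂ : G.Adj b (p x₂))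
    (h₃ : G.Adj b (p x₃)) (h₁₂ : x₁ ≠ x₂) (h₁₃ : x₁ ≠ x₃) (h₂₃ : x₂ ≠ x₃) :
    ∃ l < k, 1 ≤ l ∧ ∃ q, IsCyc G l q ∧ (G.induce (Set.range q)ᶜ).Connected := by
  classical
  -- going once around the cycle shows that odd distances between neighbours of `b` exist
  have hex : ∃ g, Odd g ∧ ∃ x, G.Adj b (p x) ∧ G.Adj b (p (x + (g : ℕ))) :=
    ⟨2 * k + 1, by simp, x₁, h₁, by rw [ZMod.natCast_self, add_zero]; exact h₁⟩
  obtain ⟨g, ⟨hodd, x, hx, hxg⟩, hmin⟩ : ∃ g, (Odd g ∧ ∃ x, G.Adj b (p x) ∧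
      G.Adj b (p (x + (g : ℕ)))) ∧ ∀ j < g, ¬ (Odd j ∧ ∃ x, G.Adj b (p x) ∧
      G.Adj b (p (x + (j : ℕ)))) :=
    ⟨Nat.find hex, Nat.find_spec hex, fun _ => Nat.find_min hex⟩
  have hgap : ∀ j, 0 < j → j < g → ¬ G.Adj b (p (x + (j : ℕ))) := by
    intro j h0 hj hbj
    rcases Nat.even_or_odd j with he | ho
    · refine hmin (g - j) (by omega) ⟨Nat.Odd.sub_even hj.le hodd he, _, hbj, ?_⟩
      rw [add_assoc, ← Nat.cast_add, Nat.add_sub_cancel' hj.le]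
      exact hxg
    · exact hmin j hj ⟨ho, _, hx, hbj⟩
  have htri : ∀ y z, G.Adj b (p y) → G.Adj b (p z) → ¬ G.Adj (p y) (p z) :=
    fun y z hy hz hyz => not_adj_of_cliqueFree hG hy hyz hz
  obtain ⟨j, hj1, hj2, hbj⟩ : ∃ j, g + 2 ≤ j ∧ j + 1 ≤ 2 * k ∧ G.Adj b (p (x + (j : ℕ))) := by
    obtain ⟨n₁, hn₁, rfl⟩ := exists_natCast_add x x₁
    obtain ⟨n₂, hn₂, rfl⟩ := exists_natCast_add x x₂
    obtain ⟨n₃, hn₃, rfl⟩ := exists_natCast_add x x₃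
    obtain ⟨j, hj, hbj, hj0, hjg⟩ : ∃ j < 2 * k + 1, G.Adj b (p (x + (j : ℕ))) ∧ j ≠ 0 ∧ j ≠ g := by
      have hn₁₂ : n₁ ≠ n₂ := fun h => h₁₂ (by rw [h])
      have hn₁₃ : n₁ ≠ n₃ := fun h => h₁₃ (by rw [h])
      have hn₂₃ : n₂ ≠ n₃ := fun h => h₂₃ (by rw [h])
      by_cases c₁ : n₁ ≠ 0 ∧ n₁ ≠ g
      · exact ⟨n₁, hn₁, h₁, c₁⟩
      by_cases c₂ : n₂ ≠ 0 ∧ n₂ ≠ g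
      · exact ⟨n₂, hn₂, h₂, c₂⟩
      exact ⟨n₃, hn₃, h₃, by omega, by omega⟩
    have hgj : g < j := by
      by_contra hcon
      exact hgap j (by omega) (by omega) hbj
    have e1 : j ≠ g + 1 := by
      rintro rfl
      exact htri _ _ hxg hbj ((h.cyc.adj_natCast_iff x (by omega) (by omega)).2 (.inl rfl))
    have e2 : j ≠ 2 * k := by
      rintro rfl
      have := (h.cyc.adj_natCast_iff x (i := 0) (j := 2 * k) (by omega) (by omega)).2 (by simp)
      exact htri _ _ hx hbj (by simpa using this)
    exact ⟨j, by omega, by omega, hbj⟩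
  obtain ⟨m, rfl⟩ := hodd
  have hpb : ∀ i, p i ≠ b := by
    rintro i rfl
    exact h.notMem_right _ hb
  -- the shorter cycle: the arc from `x` to `x + g`, closed up by `b`
  set q : ℕ → V := fun i => if i ≤ 2 * m + 1 then p (x + (i : ℕ)) else b with hq
  have hm : m ≠ 0 := by
    rintro rfl
    have := (h.cyc.adj_natCast_iff x (i := 0) (j := 1) (by omega) (by omega)).2 (.inl rfl)
    exact htri _ _ hx hxg (by simpa using this)
  have hcyc : IsCyc G (m + 1) (fun i : ZMod (2 * (m + 1) + 1) => q i.val) := by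
    refine isCyc_of_nat (by omega) q ?_ ?_
    · intro i l hil hl
      simp only [hq, if_pos (show i ≤ 2 * m + 1 by omega)]
      split_ifs with hl2
      · rw [Ne, h.cyc.natCast_inj x (by omega) (by omega)]
        omega
      · exact hpb _
    · intro i l hil hl
      simp only [hq, if_pos (show i ≤ 2 * m + 1 by omega)]
      split_ifs with hl2
      · rw [h.cyc.adj_natCast_iff x hil (by omega)]
        omega
      · rw [SimpleGraph.adj_comm]
        constructor
        · intro hbi
          by_contra hcon
          exact hgap i (by omega) (by omega) hbi
        · intro hc
          obtain rfl | rfl : i = 0 ∨ i = 2 * m + 1 := by omega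
          · simpa using hx
          · exact hxg
  have hrange : ∀ v, v ∈ (Set.range fun i : ZMod (2 * (m + 1) + 1) => q i.val)ᶜ ↔
      v ≠ b ∧ ∀ i ≤ 2 * m + 1, p (x + (i : ℕ)) ≠ v := by
    intro v
    simp only [Set.mem_compl_iff, Set.mem_range, not_exists]
    constructor
    · intro hv
      have hv' : ∀ i ≤ 2 * m + 2, q i ≠ v := by
        intro i hi
        have := hv (i : ℕ)
        rwa [ZMod.val_natCast_of_lt (by omega)] at this
      refine ⟨fun hvb => hv' (2 * m + 2) le_rfl (by simp [hq, hvb]), fun i hi => ?_⟩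
      have := hv' i (by omega)
      simpa [hq, hi] using this
    · rintro ⟨hvb, hv⟩ i
      simp only [hq]
      split_ifs with hi
      · exact hv _ hi
      · exact hvb.symm
  have harc : ∀ i, 2 * m + 1 < i → i ≤ 2 * k →
      p (x + (i : ℕ)) ∈ (Set.range fun i : ZMod (2 * (m + 1) + 1) => q i.val)ᶜ := by
    intro i hi hik
    rw [hrange]
    refine ⟨hpb _, fun l hl => ?_⟩
    rw [Ne, h.cyc.natCast_inj x (by omega) hik]
    omega
  have hA : ∀ a ∈ A, a ∈ (Set.range fun i : ZMod (2 * (m + 1) + 1) => q i.val)ᶜ := by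
    intro a ha
    rw [hrange]
    refine ⟨?_, fun l _ => ?_⟩
    · rintro rfl
      exact disjoint_left.1 h.disj ha hb
    · rintro rfl
      exact h.notMem_left _ ha
  refine ⟨m + 1, by omega, by omega, _, hcyc,
    connected_induce_of_forall (harc j (by omega) (by omega)) ?_⟩
  intro P h0 hstep
  have hP1 : ∀ n, j + n ≤ 2 * k → P (p (x + (j + n : ℕ))) := by
    intro n
    induction n with
    | zero => exact fun _ => h0
    | succ n ih =>
      intro hn
      exact hstep _ (harc _ (by omega) (by omega)) _ (harc _ (by omega) hn) (ih (by omega))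
        ((h.cyc.adj_natCast_iff x (by omega) (by omega)).2 (.inl rfl))
  have hP2 : ∀ n, 2 * m + 1 < j - n → P (p (x + (j - n : ℕ))) := by
    intro n
    induction n with
    | zero => exact fun _ => h0
    | succ n ih =>
      intro hn
      refine hstep _ (harc (j - n) (by omega) (by omega)) _ (harc _ (by omega) (by omega))
        (ih (by omega)) ?_
      exact ((h.cyc.adj_natCast_iff x (by omega) (by omega)).2 (.inl (by omega))).symm
  have hPA : ∀ a ∈ A, P a := by
    intro a ha
    rcases h.symm.adj_or_adj hE hb ha hbj.symm 0 (k - 1) (by omega) (by omega) with h' | h'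
    · rw [add_assoc, ← Nat.cast_add] at h'
      exact hstep _ (harc _ (by omega) (by omega)) _ (hA a ha) (hP1 1 (by omega)) h'.symm
    · have e : x + (j : ZMod (2 * k + 1)) + ((2 * (k - 1) + 2 : ℕ) : ZMod (2 * k + 1)) =
          x + ((j - 1 : ℕ) : ZMod (2 * k + 1)) := by
        have h1 : ((2 * (k - 1) + 2 : ℕ) : ZMod (2 * k + 1)) + 1 = 0 := by
          rw [show 2 * (k - 1) + 2 = 2 * k by omega]
          exact natCast_two_mul_add_one k
        have h2 : ((j - 1 : ℕ) : ZMod (2 * k + 1)) + 1 = (j : ℕ) := by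
          rw [← Nat.cast_succ, Nat.succ_eq_add_one, Nat.sub_add_cancel (by omega)]
        linear_combination h1 - h2
      rw [e] at h'
      exact hstep _ (harc _ (by omega) (by omega)) _ (hA a ha) (hP2 1 (by omega)) h'.symm
  intro v hv
  have hv' := (hrange v).1 hv
  rcases h.cover v with ⟨i, rfl⟩ | ha | hb'
  · obtain ⟨n, hn, rfl⟩ := exists_natCast_add x i
    have hn1 : 2 * m + 1 < n := by
      by_contra hcon
      exact hv'.2 n (by omega) rfl
    rcases le_total j n with hjn | hjn
    · have := hP1 (n - j) (by omega)
      rwa [Nat.add_sub_cancel' hjn] at this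
    · have := hP2 (j - n) (by omega)
      rwa [Nat.sub_sub_self hjn] at this
  · exact hPA _ ha
  · obtain ⟨a, ha⟩ := h.nonempty
    exact hstep _ (hA a ha) _ hv (hPA a ha) (h.adj a ha v hb')

theorem IsDecomp.exists_adj {A B : Finset V} (h : IsDecomp G k p A B) (hG : G.Connected) :
    ∃ c, (∃ a ∈ A, G.Adj (p c) a) ∨ ∃ b ∈ B, G.Adj (p c) b := by
  by_contra! hcon
  obtain ⟨a, ha⟩ := h.nonempty
  have hconn : (G.induce Set.univ).Connected := by
    rwa [SimpleGraph.Iso.connected_iff (SimpleGraph.induceUnivIso G)]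
  obtain ⟨i, hi⟩ := forall_of_connected_induce hconn (fun v => ∃ i, p i = v) (s := p 0) trivial
    ⟨0, rfl⟩ (by
      rintro _ - y - ⟨c, rfl⟩ hcy
      rcases h.cover y with hy | hy | hy
      · exact hy
      · exact absurd hcy ((hcon c).1 y hy)
      · exact absurd hcy ((hcon c).2 y hy)) a trivial
  exact h.notMem_left i (hi ▸ ha)

/-- A shortest induced odd cycle with connected complement has length five or seven, and the
vertices off it have at most two neighbours on it. -/
theorem exists_short_isDecomp [Fintype V] [DecidableEq V] (hconn : G.Connected)
    (hG : G.CliqueFree 3) (hE : UncoversAtMostOne G)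
    (hC : ∃ C : Set V, IsInducedOddCycle G C ∧ (G.induce Cᶜ).Connected) :
    ∃ k, (k = 2 ∨ k = 3) ∧ ∃ p A B, IsDecomp G k p A B ∧
      ∀ v ∈ A ∪ B, ∀ x y z, G.Adj v (p x) → G.Adj v (p y) → G.Adj v (p z) → x ≠ y → x ≠ z →
        y = z := by
  classical
  have hex : ∃ k, 1 ≤ k ∧ ∃ p : ZMod (2 * k + 1) → V, IsCyc G k p ∧
      (G.induce (Set.range p)ᶜ).Connected := by
    obtain ⟨C, hC, hconn⟩ := hC
    obtain ⟨k, hk, p, hp, rfl⟩ := isInducedOddCycle_iff.1 hC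
    exact ⟨k, hk, p, hp, hconn⟩
  obtain ⟨k, ⟨hk, p, hp, hpc⟩, hmin⟩ : ∃ k, (1 ≤ k ∧ ∃ p : ZMod (2 * k + 1) → V, IsCyc G k p ∧
      (G.induce (Set.range p)ᶜ).Connected) ∧ ∀ l < k, ¬ (1 ≤ l ∧ ∃ p : ZMod (2 * l + 1) → V,
      IsCyc G l p ∧ (G.induce (Set.range p)ᶜ).Connected) :=
    ⟨Nat.find hex, Nat.find_spec hex, fun _ => Nat.find_min hex⟩
  have hk2 : 2 ≤ k := by
    by_contra hcon
    obtain rfl : k = 1 := by omega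
    exact not_adj_of_cliqueFree hG ((hp.adj_iff 0 1).2 (by decide)) ((hp.adj_iff 1 2).2 (by decide))
      ((hp.adj_iff 0 2).2 (by decide))
  obtain ⟨A, B, h⟩ := hp.exists_isDecomp hG hE hpc
  have hthree : ∀ {A B}, IsDecomp G k p A B → ∀ v ∈ B, ∀ x y z, G.Adj v (p x) → G.Adj v (p y) →
      G.Adj v (p z) → x ≠ y → x ≠ z → y = z := by
    intro A B h v hv x y z hx hy hz hxy hxz
    by_contra hyz
    obtain ⟨l, hl, hl1, q, hq⟩ := h.exists_shorter hk2 hG hE hv hx hy hz hxy hxz hyz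
    exact hmin l hl ⟨hl1, q, hq⟩
  have hlong : ∀ {A B}, IsDecomp G k p A B → ∀ c, (∃ a ∈ A, G.Adj (p c) a) → k < 4 := by
    rintro A B h c ⟨a, ha, hca⟩
    by_contra hk4
    obtain ⟨b, hb⟩ := h.symm.nonempty
    have hne : ∀ i j : ℕ, i < 9 → j < 9 → i ≠ j →
        c + (i : ZMod (2 * k + 1)) ≠ c + (j : ZMod (2 * k + 1)) := by
      intro i j hi hj hij
      rw [Ne, add_right_inj, natCast_inj_of_lt (by omega) (by omega)]
      exact hij
    have hpos : ∀ s t, s < t → t ≤ 3 → ∃ i : ℕ, (i = 2 * s + 1 ∨ i = 2 * t + 2) ∧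
        G.Adj b (p (c + i)) := by
      intro s t hst ht
      rcases h.adj_or_adj hE ha hb hca s t hst (by omega) with h' | h'
      · exact ⟨_, .inl rfl, h'⟩
      · exact ⟨_, .inr rfl, h'⟩
    -- the pairs of positions (1, 4), (3, 6), (5, 8) are disjoint and give three neighbours of `b`
    obtain ⟨i₁, hi₁, h₁⟩ := hpos 0 1 (by omega) (by omega)
    obtain ⟨i₂, hi₂, h₂⟩ := hpos 1 2 (by omega) (by omega)
    obtain ⟨i₃, hi₃, h₃⟩ := hpos 2 3 (by omega) (by omega)
    exact hne i₂ i₃ (by omega) (by omega) (by omega) (hthree h b hb _ _ _ h₁ h₂ h₃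
      (hne _ _ (by omega) (by omega) (by omega)) (hne _ _ (by omega) (by omega) (by omega)))
  have hk4 : k < 4 := by
    obtain ⟨c, hc | hc⟩ := h.exists_adj hconn
    · exact hlong h c hc
    · exact hlong h.symm c hc
  refine ⟨k, by omega, p, A, B, h, fun v hv => ?_⟩
  rcases mem_union.1 hv with hv | hv
  · exact hthree h.symm v hv
  · exact hthree h v hv

end

/-! ### Recognising blow-ups -/

instance : DecidableRel G₁.Adj := fun i j =>
  decidable_of_iff (s(i, j) ∈ ([s(0, 6), s(6, 5), s(5, 4), s(4, 3), s(3, 2), s(2, 1), s(1, 0)] :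
    List (Sym2 (Fin 7))) ∧ i ≠ j) (by simp [G₁])

instance : DecidableRel G₂.Adj := fun i j =>
  decidable_of_iff (s(i, j) ∈ ([s(0, 5), s(5, 6), s(6, 10), s(10, 9), s(9, 8), s(8, 3), s(3, 2),
    s(2, 1), s(1, 0), s(6, 7), s(5, 4), s(1, 4), s(9, 7), s(3, 4), s(3, 7)] :
    List (Sym2 (Fin 11))) ∧ i ≠ j) (by simp [G₂])

/-- A graph is a blow-up of `H` iff its vertices can be sorted into classes indexed by the vertices
of `H`, of the prescribed sizes, so that adjacency is that of the classes in `H`. -/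
theorem nonempty_iso_blowup_iff {V : Type*} [Fintype V] {G : SimpleGraph V} {ι : Type}
    [DecidableEq ι] {H : SimpleGraph ι} {m : ι → ℕ} :
    Nonempty (G ≃g blowup H m) ↔ ∃ cl : V → ι, (∀ v w, G.Adj v w ↔ H.Adj (cl v) (cl w)) ∧
      ∀ i, #{v | cl v = i} = m i := by
  constructor
  · rintro ⟨e⟩
    refine ⟨fun v => (e v).1, fun v w => ?_, fun i => ?_⟩
    · rw [← e.map_adj_iff]
      rfl
    · rw [← Fintype.card_subtype, ← Fintype.card_fin (m i)]
      refine Fintype.card_congr ((e.toEquiv.subtypeEquiv (q := fun x => x.1 = i)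
        fun v => Iff.rfl).trans (Equiv.sigmaSubtype i))
  · rintro ⟨cl, hadj, hcard⟩
    let e : V ≃ Σ i, Fin (m i) := (Equiv.sigmaFiberEquiv cl).symm.trans
      (Equiv.sigmaCongrRight fun i => Fintype.equivFinOfCardEq
        (by rw [Fintype.card_subtype, hcard]))
    refine ⟨⟨e, ?_⟩⟩
    intro v w
    rw [hadj]
    rfl

/-- To recognise `G` as a blow-up it suffices to distribute the cycle, `A` and `B` over the classes
by maps `t`, `f` and `g` that respect adjacency. -/
theorem IsDecomp.nonempty_iso_blowup {V : Type*} [Fintype V] {G : SimpleGraph V} {k : ℕ}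
    {p : ZMod (2 * k + 1) → V} {A B : Finset V} (h : IsDecomp G k p A B) {ι : Type}
    [DecidableEq ι] {H : SimpleGraph ι} {m : ι → ℕ} (t : ZMod (2 * k + 1) → ι) (f g : V → ι)
    (ht : ∀ i j, H.Adj (t i) (t j) ↔ j = i + 1 ∨ i = j + 1)
    (hf : ∀ a ∈ A, ∀ i, G.Adj (p i) a ↔ H.Adj (t i) (f a))
    (hg : ∀ b ∈ B, ∀ i, G.Adj (p i) b ↔ H.Adj (t i) (g b))
    (hfg : ∀ a ∈ A, ∀ b ∈ B, H.Adj (f a) (g b))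
    (hff : ∀ a ∈ A, ∀ b ∈ A, ¬ H.Adj (f a) (f b))
    (hgg : ∀ a ∈ B, ∀ b ∈ B, ¬ H.Adj (g a) (g b))
    (hm : ∀ x, m x = #{i | t i = x} + #{a ∈ A | f a = x} + #{b ∈ B | g b = x}) :
    Nonempty (G ≃g blowup H m) := by
  classical
  rw [nonempty_iso_blowup_iff]
  have hinv : ∀ i, Function.invFun p (p i) = i := Function.leftInverse_invFun h.cyc.inj
  set cl : V → ι := fun v => if v ∈ A then f v else if v ∈ B then g v else t (Function.invFun p v)
    with hcl
  have hclA : ∀ v ∈ A, cl v = f v := fun v hv => by simp [hcl, hv]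
  have hclB : ∀ v ∈ B, cl v = g v := fun v hv => by
    have : v ∉ A := fun h' => disjoint_left.1 h.disj h' hv
    simp [hcl, hv, this]
  have hclp : ∀ i, cl (p i) = t i := fun i => by
    simp [hcl, h.notMem_left, h.notMem_right, hinv]
  refine ⟨cl, ?_, fun x => ?_⟩
  · intro v w
    rcases h.cover v with ⟨i, rfl⟩ | hv | hv <;> rcases h.cover w with ⟨j, rfl⟩ | hw | hw
    · rw [hclp, hclp, ht, h.cyc.adj_iff]
    · rw [hclp, hclA w hw, hf w hw]
    · rw [hclp, hclB w hw, hg w hw]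
    · rw [hclp, hclA v hv, G.adj_comm, hf v hv, H.adj_comm]
    · rw [hclA v hv, hclA w hw]
      exact iff_of_false (h.indep_left v hv w hw) (hff v hv w hw)
    · rw [hclA v hv, hclB w hw]
      exact iff_of_true (h.adj v hv w hw) (hfg v hv w hw)
    · rw [hclp, hclB v hv, G.adj_comm, hg v hv, H.adj_comm]
    · rw [hclB v hv, hclA w hw]
      exact iff_of_true (h.adj w hw v hv).symm (hfg w hw v hv).symm
    · rw [hclB v hv, hclB w hw]
      exact iff_of_false (h.indep_right v hv w hw) (hgg v hv w hw)
  · have hsplit : (univ.filter fun v => cl v = x) =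
        ((univ.filter fun i => t i = x).image p ∪ A.filter fun a => f a = x) ∪
          B.filter fun b => g b = x := by
      ext v
      simp only [mem_filter, mem_univ, true_and, mem_union, mem_image]
      rcases h.cover v with ⟨i, rfl⟩ | hv | hv
      · simp [hclp, h.notMem_left, h.notMem_right, h.cyc.inj.eq_iff]
      · have h1 : v ∉ B := fun h' => disjoint_left.1 h.disj hv h'
        have h2 : ∀ i, p i ≠ v := by rintro i rfl; exact h.notMem_left _ hv
        simp [hclA v hv, hv, h1, h2]
      · have h1 : v ∉ A := fun h' => disjoint_left.1 h.disj h' hv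
        have h2 : ∀ i, p i ≠ v := by rintro i rfl; exact h.notMem_right _ hv
        simp [hclB v hv, hv, h1, h2]
    rw [hsplit, card_union_of_disjoint, card_union_of_disjoint, card_image_of_injective _ h.cyc.inj,
      hm]
    · rw [disjoint_left]
      intro v hv hv2
      obtain ⟨i, -, rfl⟩ := mem_image.1 hv
      exact h.notMem_left _ (mem_filter.1 hv2).1
    · rw [disjoint_left]
      intro v hv hv2
      rcases mem_union.1 hv with hv | hv
      · obtain ⟨i, -, rfl⟩ := mem_image.1 hv
        exact h.notMem_right _ (mem_filter.1 hv2).1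
      · exact disjoint_left.1 h.disj (mem_filter.1 hv).1 (mem_filter.1 hv2).1

/-! ### Cycles of length five -/

section

variable {V : Type*} {G : SimpleGraph V} {k : ℕ} {p : ZMod (2 * k + 1) → V} {A B : Finset V}

theorem IsDecomp.not_adj_right (h : IsDecomp G k p A B) (hG : G.CliqueFree 3) {a b : V}
    (ha : a ∈ A) (hb : b ∈ B) {c : ZMod (2 * k + 1)} (hca : G.Adj (p c) a) : ¬ G.Adj (p c) b :=
  not_adj_of_cliqueFree hG hca (h.adj a ha b hb)

theorem IsCyc.not_adj_succ (h : IsCyc G k p) (hG : G.CliqueFree 3) {v : V} {c : ZMod (2 * k + 1)}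
    (hcv : G.Adj (p c) v) : ¬ G.Adj (p (c + 1)) v := fun h' =>
  not_adj_of_cliqueFree hG ((h.adj_iff c (c + 1)).2 (.inl rfl)) h' hcv

end

theorem zmod_five (i : ZMod (2 * 2 + 1)) : i = 0 ∨ i = 1 ∨ i = 2 ∨ i = 3 ∨ i = 4 := by
  revert i; decide

theorem forall_zmod_five {P : ZMod (2 * 2 + 1) → Prop} (h0 : P 0) (h1 : P 1) (h2 : P 2) (h3 : P 3)
    (h4 : P 4) (i) : P i := by
  rcases zmod_five i with rfl | rfl | rfl | rfl | rfl <;> assumption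

theorem card_filter_eq_zero_of_forall {V ι : Type*} [DecidableEq ι] {S : Finset V} {f : V → ι}
    {x : ι}
    (h : ∀ v ∈ S, f v ≠ x) : #{v ∈ S | f v = x} = 0 := by
  rw [card_eq_zero, filter_eq_empty_iff]
  exact h

/-- The pentagon `u₅ u₆ u₇ u₈ u₄` of `G₂`. -/
def pentagon₁ : ZMod (2 * 2 + 1) → Fin 11 := ![4, 5, 6, 7, 3]

/-- The pentagon `u₈ u₇ u₆ u₅ u₄` of `G₂`. -/
def pentagon₂ : ZMod (2 * 2 + 1) → Fin 11 := ![7, 6, 5, 4, 3]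

theorem G₂_adj_pentagon₁ :
    ∀ i j, G₂.Adj (pentagon₁ i) (pentagon₁ j) ↔ j = i + 1 ∨ i = j + 1 := by
  decide

theorem G₂_adj_pentagon₂ :
    ∀ i j, G₂.Adj (pentagon₂ i) (pentagon₂ j) ↔ j = i + 1 ∨ i = j + 1 := by
  decide

theorem card_pentagon₁_eq :
    ∀ x, #{i | pentagon₁ i = x} = (![0, 0, 0, 1, 1, 1, 1, 1, 0, 0, 0] : Fin 11 → ℕ) x := by
  decide

theorem card_pentagon₂_eq :
    ∀ x, #{i | pentagon₂ i = x} = (![0, 0, 0, 1, 1, 1, 1, 1, 0, 0, 0] : Fin 11 → ℕ) x := by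
  decide

section

variable {V : Type*} [Fintype V] {G : SimpleGraph V} {p : ZMod (2 * 2 + 1) → V}
  {A B : Finset V}

/-- The path `2 3 4` of the pentagon becomes `u₆ u₅ u₄`, and the vertices `1` and `0` join `A` and
`B` to form a complete bipartite graph with classes `u₇`, `u₁₀` and `u₈`, `u₁₁`. -/
theorem IsDecomp.five_F₃ (h : IsDecomp G 2 p A B)
    (hA0 : ∀ a ∈ A, G.Adj (p 0) a) (hA : ∀ a ∈ A, ∀ i, G.Adj (p i) a → i = 0 ∨ i = 2)
    (hB1 : ∀ b ∈ B, G.Adj (p 1) b) (hB : ∀ b ∈ B, ∀ i, G.Adj (p i) b → i = 1 ∨ i = 4) :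
    F₃ G := by
  classical
  set f : V → Fin 11 := fun a => if G.Adj (p 2) a then 6 else 9 with hf
  set g : V → Fin 11 := fun b => if G.Adj (p 4) b then 7 else 10 with hg
  have hf2 : ∀ a, f a = 6 ∨ f a = 9 := fun a => by simp only [hf]; split_ifs <;> simp
  have hg2 : ∀ b, g b = 7 ∨ g b = 10 := fun b => by simp only [hg]; split_ifs <;> simp
  have hfs : #A = #{a ∈ A | f a = 6} + #{a ∈ A | f a = 9} := by
    rw [card_eq_sum_card_fiberwise (f := f) (t := {6, 9}) (fun b _ => by simpa using hf2 b)]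
    simp
  have hgs : #B = #{b ∈ B | g b = 7} + #{b ∈ B | g b = 10} := by
    rw [card_eq_sum_card_fiberwise (f := g) (t := {7, 10}) (fun b _ => by simpa using hg2 b)]
    simp
  have hfz : ∀ x, x ≠ 6 → x ≠ 9 → #{a ∈ A | f a = x} = 0 := by
    intro x h0 h2
    refine card_filter_eq_zero_of_forall fun b _ => ?_
    rcases hf2 b with h' | h' <;> rw [h'] <;> exact Ne.symm ‹_›
  have hgz : ∀ x, x ≠ 7 → x ≠ 10 → #{b ∈ B | g b = x} = 0 := by
    intro x h0 h2
    refine card_filter_eq_zero_of_forall fun b _ => ?_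
    rcases hg2 b with h' | h' <;> rw [h'] <;> exact Ne.symm ‹_›
  have hc := h.card_eq
  refine ⟨#A, #{a ∈ A | f a = 6} + 1, #{b ∈ B | g b = 7} + 1, card_pos.2 h.nonempty,
    by omega, by omega, by omega, by omega, ?_⟩
  refine h.nonempty_iso_blowup pentagon₂ f g G₂_adj_pentagon₂ ?_ ?_ ?_ ?_ ?_ ?_
  · intro a ha
    have hn : ∀ i, i ≠ 0 → i ≠ 2 → ¬ G.Adj (p i) a := fun i h0 h2 h' =>
      (hA a ha i h').elim h0 h2
    simp only [hf]
    split_ifs with c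
    · exact forall_zmod_five (iff_of_true (hA0 a ha) (by decide))
        (iff_of_false (hn 1 (by decide) (by decide)) (by decide)) (iff_of_true c (by decide))
        (iff_of_false (hn 3 (by decide) (by decide)) (by decide))
        (iff_of_false (hn 4 (by decide) (by decide)) (by decide))
    · exact forall_zmod_five (iff_of_true (hA0 a ha) (by decide))
        (iff_of_false (hn 1 (by decide) (by decide)) (by decide)) (iff_of_false c (by decide))
        (iff_of_false (hn 3 (by decide) (by decide)) (by decide))
        (iff_of_false (hn 4 (by decide) (by decide)) (by decide))
  · intro b hb
    have hn : ∀ i, i ≠ 1 → i ≠ 4 → ¬ G.Adj (p i) b := fun i h0 h2 h' =>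
      (hB b hb i h').elim h0 h2
    simp only [hg]
    split_ifs with c
    · exact forall_zmod_five (iff_of_false (hn 0 (by decide) (by decide)) (by decide))
        (iff_of_true (hB1 b hb) (by decide))
        (iff_of_false (hn 2 (by decide) (by decide)) (by decide))
        (iff_of_false (hn 3 (by decide) (by decide)) (by decide)) (iff_of_true c (by decide))
    · exact forall_zmod_five (iff_of_false (hn 0 (by decide) (by decide)) (by decide))
        (iff_of_true (hB1 b hb) (by decide))
        (iff_of_false (hn 2 (by decide) (by decide)) (by decide))
        (iff_of_false (hn 3 (by decide) (by decide)) (by decide)) (iff_of_false c (by decide))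
  · intro a _ b _
    rcases hf2 a with h' | h' <;> rw [h'] <;> rcases hg2 b with h' | h' <;> rw [h'] <;> decide
  · intro a _ b _
    rcases hf2 a with h' | h' <;> rw [h'] <;> rcases hf2 b with h' | h' <;> rw [h'] <;> decide
  · intro a _ b _
    rcases hg2 a with h' | h' <;> rw [h'] <;> rcases hg2 b with h' | h' <;> rw [h'] <;> decide
  · intro x
    rw [card_pentagon₂_eq]
    fin_cases x <;> simp [hfz, hgz] <;> omega

/-- The vertex `1` is a twin of the vertices of `A`, forming `u₇`, and the vertices of `B` are
sorted by whether they see `3` (twins of the vertex `2`, in `u₆`), `4` (twins of `0`, in `u₈`) or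
neither. -/
theorem IsDecomp.five_F₄ (h : IsDecomp G 2 p A B) (hG : G.CliqueFree 3)
    (hA : ∀ a ∈ A, ∀ i, G.Adj (p i) a ↔ i = 0 ∨ i = 2)
    (hB1 : ∀ b ∈ B, G.Adj (p 1) b)
    (hB3 : ∃ b ∈ B, G.Adj (p 3) b) (hB4 : ∃ b ∈ B, G.Adj (p 4) b) : F₄ G := by
  classical
  obtain ⟨a₀, ha₀⟩ := h.nonempty
  have hb0 : ∀ b ∈ B, ¬ G.Adj (p 0) b := fun b hb =>
    h.not_adj_right hG ha₀ hb ((hA a₀ ha₀ 0).2 (.inl rfl))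
  have hb2 : ∀ b ∈ B, ¬ G.Adj (p 2) b := fun b hb =>
    h.not_adj_right hG ha₀ hb ((hA a₀ ha₀ 2).2 (.inr rfl))
  have hb34 : ∀ b, G.Adj (p 3) b → ¬ G.Adj (p 4) b := fun b hb => h.cyc.not_adj_succ hG hb
  set g : V → Fin 11 := fun b => if G.Adj (p 3) b then 5 else if G.Adj (p 4) b then 7 else 10
    with hg
  have hg3 : ∀ b, g b = 5 ∨ g b = 7 ∨ g b = 10 := by
    intro b
    simp only [hg]
    split_ifs <;> simp
  have hsum : #B = #{b ∈ B | g b = 5} + #{b ∈ B | g b = 7} + #{b ∈ B | g b = 10} := by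
    rw [card_eq_sum_card_fiberwise (f := g) (t := {5, 7, 10}) (fun b _ => by simpa using hg3 b)]
    simp [add_assoc]
  have hz : ∀ x, x ≠ 5 → x ≠ 7 → x ≠ 10 → #{b ∈ B | g b = x} = 0 := by
    intro x h0 h2 h4
    refine card_filter_eq_zero_of_forall fun b _ => ?_
    rcases hg3 b with h' | h' | h' <;> rw [h'] <;> exact Ne.symm ‹_›
  have h5 : 0 < #{b ∈ B | g b = 5} := by
    obtain ⟨b, hb, hb3⟩ := hB3
    exact card_pos.2 ⟨b, mem_filter.2 ⟨hb, by simp [hg, hb3]⟩⟩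
  have h7 : 0 < #{b ∈ B | g b = 7} := by
    obtain ⟨b, hb, hb4⟩ := hB4
    have : ¬ G.Adj (p 3) b := fun h' => hb34 b h' hb4
    exact card_pos.2 ⟨b, mem_filter.2 ⟨hb, by simp [hg, hb4, this]⟩⟩
  have hc := h.card_eq
  refine ⟨#A, #{b ∈ B | g b = 5} + 1, #{b ∈ B | g b = 7} + 1, by omega, by omega, by omega,
    by omega, by omega, by omega, ?_⟩
  refine h.nonempty_iso_blowup pentagon₂ (fun _ => 6) g G₂_adj_pentagon₂ ?_ ?_ ?_ ?_ ?_ ?_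
  · intro a ha i
    rw [hA a ha]
    revert i
    decide
  · intro b hb
    simp only [hg]
    split_ifs with c3 c4
    · exact forall_zmod_five (iff_of_false (hb0 b hb) (by decide))
        (iff_of_true (hB1 b hb) (by decide)) (iff_of_false (hb2 b hb) (by decide))
        (iff_of_true c3 (by decide)) (iff_of_false (hb34 b c3) (by decide))
    · exact forall_zmod_five (iff_of_false (hb0 b hb) (by decide))
        (iff_of_true (hB1 b hb) (by decide)) (iff_of_false (hb2 b hb) (by decide))
        (iff_of_false c3 (by decide)) (iff_of_true c4 (by decide))
    · exact forall_zmod_five (iff_of_false (hb0 b hb) (by decide))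
        (iff_of_true (hB1 b hb) (by decide)) (iff_of_false (hb2 b hb) (by decide))
        (iff_of_false c3 (by decide)) (iff_of_false c4 (by decide))
  · intro a _ b _
    rcases hg3 b with h' | h' | h' <;> rw [h'] <;> decide
  · intro _ _ _ _
    decide
  · intro b _ b' _
    rcases hg3 b with h' | h' | h' <;> rw [h'] <;> rcases hg3 b' with h' | h' | h' <;> rw [h'] <;>
      decide
  · intro x
    rw [card_pentagon₂_eq]
    fin_cases x <;> simp [hz] <;> omega

variable [DecidableEq V]

/-- The case of a pentagon in `IsDecomp.adj_or_adj`: if `c` sees `A`, then every vertex of `B`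
sees a neighbour of `c` on the pentagon. -/
theorem IsDecomp.five (h : IsDecomp G 2 p A B) (hE : UncoversAtMostOne G) {a b : V} (ha : a ∈ A)
    (hb : b ∈ B) {c : ZMod (2 * 2 + 1)} (hca : G.Adj (p c) a) :
    G.Adj (p (c + 1)) b ∨ G.Adj (p (c + 4)) b := by
  have := h.adj_or_adj hE ha hb hca 0 1 (by omega) (by omega)
  simpa [G.adj_comm b] using this

/-- The vertices of `B` see `1`, `4` or both. Those seeing both are twins of the vertex `0` and join
the class of `u₅`. The assumption `hB` on `1` is harmless up to a reflection of the pentagon. -/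
theorem IsDecomp.five_single_aux (h : IsDecomp G 2 p A B) (hG : G.CliqueFree 3)
    (hE : UncoversAtMostOne G) (hA : ∀ a ∈ A, ∀ i, G.Adj (p i) a ↔ i = 0)
    (hB : ∃ b ∈ B, G.Adj (p 1) b) : F₁₁ G ∨ F₂₁ G := by
  classical
  obtain ⟨a₀, ha₀⟩ := h.nonempty
  have hb0 : ∀ b ∈ B, ¬ G.Adj (p 0) b := fun b hb =>
    h.not_adj_right hG ha₀ hb ((hA a₀ ha₀ 0).2 rfl)
  have hb14 : ∀ b ∈ B, G.Adj (p 1) b ∨ G.Adj (p 4) b := fun b hb =>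
    h.five hE ha₀ hb ((hA a₀ ha₀ 0).2 rfl)
  have hb2 : ∀ b ∈ B, ¬ G.Adj (p 2) b := by
    intro b hb hadj
    rcases h.symm.five hE hb ha₀ hadj with h' | h' <;> rw [hA a₀ ha₀] at h' <;>
      exact absurd h' (by decide)
  have hb3 : ∀ b ∈ B, ¬ G.Adj (p 3) b := by
    intro b hb hadj
    rcases h.symm.five hE hb ha₀ hadj with h' | h' <;> rw [hA a₀ ha₀] at h' <;>
      exact absurd h' (by decide)
  set g : V → Fin 11 := fun b =>
    if G.Adj (p 1) b then (if G.Adj (p 4) b then 4 else 0) else 2 with hg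
  have hg3 : ∀ b, g b = 0 ∨ g b = 2 ∨ g b = 4 := by
    intro b
    simp only [hg]
    split_ifs <;> simp
  have hsum : #B = #{b ∈ B | g b = 0} + #{b ∈ B | g b = 2} + #{b ∈ B | g b = 4} := by
    rw [card_eq_sum_card_fiberwise (f := g) (t := {0, 2, 4}) (fun b _ => by simpa using hg3 b)]
    simp [add_assoc]
  have hz : ∀ x, x ≠ 0 → x ≠ 2 → x ≠ 4 → #{b ∈ B | g b = x} = 0 := by
    intro x h0 h2 h4
    refine card_filter_eq_zero_of_forall fun b _ => ?_
    rcases hg3 b with h' | h' | h' <;> rw [h'] <;> exact Ne.symm ‹_›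
  have key : IsG₂ G ![#{b ∈ B | g b = 0}, #A, #{b ∈ B | g b = 2}, 1,
      #A + 1 - (#{b ∈ B | g b = 0} + #{b ∈ B | g b = 2}), 1, 1, 1, 0, 0, 0] := by
    refine h.nonempty_iso_blowup pentagon₁ (fun _ => 1) g G₂_adj_pentagon₁ ?_ ?_ ?_ ?_ ?_ ?_
    · intro a ha i
      rw [hA a ha]
      revert i
      decide
    · intro b hb
      have h1 := hb14 b hb
      simp only [hg]
      split_ifs with c1 c4
      · exact forall_zmod_five (iff_of_false (hb0 b hb) (by decide)) (iff_of_true c1 (by decide))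
          (iff_of_false (hb2 b hb) (by decide)) (iff_of_false (hb3 b hb) (by decide))
          (iff_of_true c4 (by decide))
      · exact forall_zmod_five (iff_of_false (hb0 b hb) (by decide)) (iff_of_true c1 (by decide))
          (iff_of_false (hb2 b hb) (by decide)) (iff_of_false (hb3 b hb) (by decide))
          (iff_of_false c4 (by decide))
      · exact forall_zmod_five (iff_of_false (hb0 b hb) (by decide)) (iff_of_false c1 (by decide))
          (iff_of_false (hb2 b hb) (by decide)) (iff_of_false (hb3 b hb) (by decide))
          (iff_of_true (h1.resolve_left c1) (by decide))
    · intro a _ b _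
      rcases hg3 b with h' | h' | h' <;> rw [h'] <;> decide
    · intro _ _ _ _
      decide
    · intro b _ b' _
      rcases hg3 b with h' | h' | h' <;> rw [h'] <;> rcases hg3 b' with h' | h' | h' <;> rw [h'] <;>
        decide
    · have hc := h.card_eq
      intro x
      rw [card_pentagon₁_eq]
      fin_cases x <;> simp [hz]
      omega
  have hs : #{b ∈ B | g b = 2} < #A := by
    obtain ⟨b, hb, hb1⟩ := hB
    rw [h.card_eq]
    refine card_lt_card (filter_ssubset.2 ⟨b, hb, ?_⟩)
    simp only [hg, if_pos hb1]
    split_ifs <;> decide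
  have hpos : 1 ≤ #A := card_pos.2 h.nonempty
  have hc := h.card_eq
  by_cases hr : #{b ∈ B | g b = 0} = #A
  · left
    have hs0 : #{b ∈ B | g b = 2} = 0 := by omega
    refine ⟨#A, hpos, ?_⟩
    rw [hr, hs0] at key
    simpa using key
  · right
    exact ⟨#A, _, _, hpos, by omega, by omega, by omega, key⟩

/-- If the vertices of `A` see a single vertex of the pentagon, `G` is a blow-up of the subgraph of
`G₂` on its first eight vertices. -/
theorem IsDecomp.five_single (h : IsDecomp G 2 p A B) (hG : G.CliqueFree 3)
    (hE : UncoversAtMostOne G) (hA : ∀ a ∈ A, ∀ i, G.Adj (p i) a ↔ i = 0) : F₁₁ G ∨ F₂₁ G := by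
  by_cases hB : ∃ b ∈ B, G.Adj (p 1) b
  · exact h.five_single_aux hG hE hA hB
  · obtain ⟨a, ha⟩ := h.nonempty
    obtain ⟨b, hb⟩ := h.symm.nonempty
    refine (h.reflect 0).five_single_aux hG hE ?_ ⟨b, hb, ?_⟩
    · intro a ha i
      rw [hA a ha]
      revert i
      decide
    · rcases h.five hE ha hb ((hA a ha 0).2 rfl) with h' | h'
      · exact absurd ⟨b, hb, h'⟩ hB
      · exact h'

/-- The vertices of `A` see exactly two vertices of the pentagon, at distance two. -/
theorem IsDecomp.five_double (h : IsDecomp G 2 p A B) (hG : G.CliqueFree 3)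
    (hE : UncoversAtMostOne G) (hA : ∀ a ∈ A, ∀ i, G.Adj (p i) a → i = 0 ∨ i = 2)
    (hA0 : ∃ a ∈ A, G.Adj (p 0) a) (hA2 : ∃ a ∈ A, G.Adj (p 2) a) :
    F₁₁ G ∨ F₂₁ G ∨ F₃ G ∨ F₄ G := by
  obtain ⟨a₀, ha₀, h0⟩ := hA0
  obtain ⟨a₂, ha₂, h2⟩ := hA2
  have hb0 : ∀ b ∈ B, ¬ G.Adj (p 0) b := fun b hb => h.not_adj_right hG ha₀ hb h0
  have hb2 : ∀ b ∈ B, ¬ G.Adj (p 2) b := fun b hb => h.not_adj_right hG ha₂ hb h2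
  have hb14 : ∀ b ∈ B, G.Adj (p 1) b ∨ G.Adj (p 4) b := fun b hb => h.five hE ha₀ hb h0
  have hb31 : ∀ b ∈ B, G.Adj (p 3) b ∨ G.Adj (p 1) b := fun b hb => h.five hE ha₂ hb h2
  have hn : ∀ a ∈ A, ∀ i, i ≠ 0 → i ≠ 2 → ¬ G.Adj (p i) a := fun a ha i h0 h2 h' =>
    (hA a ha i h').elim h0 h2
  have hadj4 : ∀ b ∈ B, G.Adj (p 4) b → ∀ a ∈ A, G.Adj (p 0) a := fun b hb h' a ha =>
    (h.symm.five hE hb ha h').resolve_right (hn a ha _ (by decide) (by decide))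
  have hadj3 : ∀ b ∈ B, G.Adj (p 3) b → ∀ a ∈ A, G.Adj (p 2) a := fun b hb h' a ha =>
    (h.symm.five hE hb ha h').resolve_left (hn a ha _ (by decide) (by decide))
  by_cases e3 : ∃ b ∈ B, G.Adj (p 3) b <;> by_cases e4 : ∃ b ∈ B, G.Adj (p 4) b
  · right; right; right
    obtain ⟨b₃, hb₃, h3⟩ := e3
    obtain ⟨b₄, hb₄, h4⟩ := e4
    refine h.five_F₄ hG ?_ ?_ ⟨b₃, hb₃, h3⟩ ⟨b₄, hb₄, h4⟩
    · intro a ha i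
      refine ⟨hA a ha i, ?_⟩
      rintro (rfl | rfl)
      · exact hadj4 b₄ hb₄ h4 a ha
      · exact hadj3 b₃ hb₃ h3 a ha
    · intro b hb
      by_contra h1
      exact h.cyc.not_adj_succ hG ((hb31 b hb).resolve_right h1) ((hb14 b hb).resolve_left h1)
  · right; right; left
    obtain ⟨b₃, hb₃, h3⟩ := e3
    push Not at e4
    refine (h.reflect 2).five_F₃ (hadj3 b₃ hb₃ h3) ?_
      (fun b hb => (hb14 b hb).resolve_right (e4 b hb)) ?_
    · intro a ha i hi
      have h02 : ∀ i : ZMod (2 * 2 + 1), 2 - i = 0 ∨ 2 - i = 2 → i = 0 ∨ i = 2 := by decide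
      exact h02 i (hA a ha _ hi)
    · intro b hb i
      revert i
      exact forall_zmod_five (fun h' => absurd h' (hb2 b hb)) (fun _ => .inl rfl)
        (fun h' => absurd h' (hb0 b hb)) (fun h' => absurd h' (e4 b hb)) (fun _ => .inr rfl)
  · right; right; left
    obtain ⟨b₄, hb₄, h4⟩ := e4
    push Not at e3
    refine h.five_F₃ (hadj4 b₄ hb₄ h4) hA
      (fun b hb => (hb31 b hb).resolve_left (e3 b hb)) ?_
    intro b hb
    exact forall_zmod_five (fun h' => absurd h' (hb0 b hb)) (by simp)
      (fun h' => absurd h' (hb2 b hb)) (fun h' => absurd h' (e3 b hb)) (by simp)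
  · push Not at e3 e4
    have : F₁₁ G ∨ F₂₁ G := by
      refine (h.symm.rotate 1).five_single hG hE ?_
      intro b hb
      exact forall_zmod_five
        (iff_of_true ((hb31 b hb).resolve_left (e3 b hb)) rfl)
        (iff_of_false (hb2 b hb) (by decide)) (iff_of_false (e3 b hb) (by decide))
        (iff_of_false (e4 b hb) (by decide)) (iff_of_false (hb0 b hb) (by decide))
    tauto

/-- The vertices of `A` do not see exactly two vertices of the pentagon that are consecutive. -/
theorem IsDecomp.five_consecutive (h : IsDecomp G 2 p A B) (hG : G.CliqueFree 3)
    (hE : UncoversAtMostOne G) (hA : ∀ a ∈ A, ∀ i, G.Adj (p i) a → i = 0 ∨ i = 1)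
    (hA0 : ∃ a ∈ A, G.Adj (p 0) a) (hA1 : ∃ a ∈ A, G.Adj (p 1) a) : False := by
  obtain ⟨a₀, ha₀, h0⟩ := hA0
  obtain ⟨a₁, ha₁, h1⟩ := hA1
  obtain ⟨b, hb⟩ := h.symm.nonempty
  have hb4 : G.Adj (p 4) b := (h.five hE ha₀ hb h0).resolve_left (h.not_adj_right hG ha₁ hb h1)
  have hb2 : G.Adj (p 2) b := (h.five hE ha₁ hb h1).resolve_right (h.not_adj_right hG ha₀ hb h0)
  have hn : ∀ i, i ≠ 0 → i ≠ 1 → ¬ G.Adj (p i) a₀ := fun i h0 h2 h' =>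
    (hA a₀ ha₀ i h').elim h0 h2
  have ha1 : G.Adj (p 1) a₀ :=
    (h.symm.five hE hb ha₀ hb2).resolve_left (hn _ (by decide) (by decide))
  exact h.cyc.not_adj_succ hG h0 ha1

theorem exists_translate_of_card_le_two : ∀ S : Finset (ZMod (2 * 2 + 1)), S.Nonempty → #S ≤ 2 →
    ∃ t, S = {t} ∨ S = {t, t + 1} ∨ S = {t, t + 2} := by
  decide

/-- `S` is the set of vertices of the pentagon seen from `A`. -/
theorem IsDecomp.five_of_card_le_two (h : IsDecomp G 2 p A B) (hG : G.CliqueFree 3)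
    (hE : UncoversAtMostOne G) {S : Finset (ZMod (2 * 2 + 1))}
    (hS : ∀ i, i ∈ S ↔ ∃ a ∈ A, G.Adj (p i) a) (hne : S.Nonempty) (hc : #S ≤ 2)
    (hcov : ∀ a ∈ A, ∃ i, G.Adj (p i) a) : F₁₁ G ∨ F₂₁ G ∨ F₃ G ∨ F₄ G := by
  obtain ⟨t, rfl | rfl | rfl⟩ := exists_translate_of_card_le_two S hne hc
  · have h1 : ∀ a ∈ A, ∀ i, G.Adj (p i) a → i = t := fun a ha i hi => by
      simpa using (hS i).2 ⟨a, ha, hi⟩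
    have : F₁₁ G ∨ F₂₁ G := (h.rotate t).five_single hG hE fun a ha i => by
      refine ⟨fun hi => by simpa using h1 a ha _ hi, ?_⟩
      rintro rfl
      obtain ⟨j, hj⟩ := hcov a ha
      obtain rfl := h1 a ha j hj
      simpa using hj
    tauto
  · exact ((h.rotate t).five_consecutive hG hE
      (fun a ha i hi => by simpa using (hS _).2 ⟨a, ha, hi⟩)
      (by simpa using (hS t).1 (by simp)) (by simpa using (hS (t + 1)).1 (by simp))).elim
  · exact (h.rotate t).five_double hG hE
      (fun a ha i hi => by simpa using (hS _).2 ⟨a, ha, hi⟩)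
      (by simpa using (hS t).1 (by simp)) (by simpa using (hS (t + 2)).1 (by simp))

/-- The sets of vertices of the pentagon seen from `A` and from `B` are disjoint, so that one of
them has at most two elements. -/
theorem IsDecomp.five_classification (h : IsDecomp G 2 p A B) (hconn : G.Connected)
    (hG : G.CliqueFree 3) (hE : UncoversAtMostOne G) : F₁₁ G ∨ F₂₁ G ∨ F₃ G ∨ F₄ G := by
  classical
  have hsee : ∀ {A B}, IsDecomp G 2 p A B → (∃ i, ∃ a ∈ A, G.Adj (p i) a) →
      ∀ b ∈ B, ∃ i, G.Adj (p i) b := by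
    rintro A B h ⟨i, a, ha, hi⟩ b hb
    rcases h.five hE ha hb hi with h' | h' <;> exact ⟨_, h'⟩
  have hA : (∃ i, ∃ a ∈ A, G.Adj (p i) a) ∧ ∃ i, ∃ b ∈ B, G.Adj (p i) b := by
    obtain ⟨b, hb⟩ := h.symm.nonempty
    obtain ⟨a, ha⟩ := h.nonempty
    obtain ⟨c, hc | hc⟩ := h.exists_adj hconn
    · obtain ⟨i, hi⟩ := hsee h ⟨c, hc⟩ b hb
      exact ⟨⟨c, hc⟩, i, b, hb, hi⟩
    · obtain ⟨i, hi⟩ := hsee h.symm ⟨c, hc⟩ a ha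
      exact ⟨⟨i, a, ha, hi⟩, c, hc⟩
  set S : Finset (ZMod (2 * 2 + 1)) := univ.filter fun i => ∃ a ∈ A, G.Adj (p i) a with hS
  set T : Finset (ZMod (2 * 2 + 1)) := univ.filter fun i => ∃ b ∈ B, G.Adj (p i) b with hT
  have hdisj : Disjoint S T := by
    rw [disjoint_left]
    intro i hi hi'
    obtain ⟨a, ha, hia⟩ := (mem_filter.1 hi).2
    obtain ⟨b, hb, hib⟩ := (mem_filter.1 hi').2
    exact h.not_adj_right hG ha hb hia hib
  have hcard : #S + #T ≤ 5 := by
    rw [← card_union_of_disjoint hdisj]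
    exact card_le_univ _
  rcases (by omega : #S ≤ 2 ∨ #T ≤ 2) with hc | hc
  · exact h.five_of_card_le_two hG hE (S := S) (by simp [hS])
      (by obtain ⟨i, hi⟩ := hA.1; exact ⟨i, by simpa [hS] using hi⟩) hc (hsee h.symm hA.2)
  · exact h.symm.five_of_card_le_two hG hE (S := T) (by simp [hT])
      (by obtain ⟨i, hi⟩ := hA.2; exact ⟨i, by simpa [hT] using hi⟩) hc (hsee h hA.1)

end

/-! ### Cycles of length seven -/

theorem forall_zmod_seven {P : ZMod (2 * 3 + 1) → Prop} (h0 : P 0) (h1 : P 1) (h2 : P 2) (h3 : P 3)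
    (h4 : P 4) (h5 : P 5) (h6 : P 6) (i) : P i := by
  have : ∀ i : ZMod (2 * 3 + 1), i = 0 ∨ i = 1 ∨ i = 2 ∨ i = 3 ∨ i = 4 ∨ i = 5 ∨ i = 6 := by decide
  rcases this i with rfl | rfl | rfl | rfl | rfl | rfl | rfl <;> assumption

/-- The heptagon `G₁` itself. -/
def heptagon : ZMod (2 * 3 + 1) → Fin 7 := ![0, 1, 2, 3, 4, 5, 6]

theorem G₁_adj_heptagon :
    ∀ i j, G₁.Adj (heptagon i) (heptagon j) ↔ j = i + 1 ∨ i = j + 1 := by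
  decide

theorem card_heptagon_eq : ∀ x, #{i | heptagon i = x} = 1 := by
  decide

section

variable {V : Type*} [Fintype V] {G : SimpleGraph V} {p : ZMod (2 * 3 + 1) → V} {A B : Finset V}

/-- The vertices of `A` are clones of the vertex `0`, those of `B` of its neighbours `1` and `6`. -/
theorem IsDecomp.seven_F₂₂ (h : IsDecomp G 3 p A B)
    (hA : ∀ a ∈ A, ∀ i, G.Adj (p i) a ↔ i = 1 ∨ i = 6)
    (hB : ∀ b ∈ B, (∀ i, G.Adj (p i) b ↔ i = 2 ∨ i = 0) ∨ ∀ i, G.Adj (p i) b ↔ i = 0 ∨ i = 5) :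
    F₂₂ G := by
  classical
  have hB' : ∀ b ∈ B, ¬ G.Adj (p 2) b → ∀ i, G.Adj (p i) b ↔ i = 0 ∨ i = 5 := by
    intro b hb h2
    rcases hB b hb with h' | h'
    · exact absurd ((h' 2).2 (.inl rfl)) h2
    · exact h'
  have hB2 : ∀ b ∈ B, G.Adj (p 2) b → ∀ i, G.Adj (p i) b ↔ i = 2 ∨ i = 0 := by
    intro b hb h2
    rcases hB b hb with h' | h'
    · exact h'
    · exact absurd ((h' 2).1 h2) (by decide)
  set g : V → Fin 7 := fun b => if G.Adj (p 2) b then 1 else 6 with hg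
  have hg2 : ∀ b, g b = 1 ∨ g b = 6 := fun b => by simp only [hg]; split_ifs <;> simp
  have hgs : #B = #{b ∈ B | g b = 1} + #{b ∈ B | g b = 6} := by
    rw [card_eq_sum_card_fiberwise (f := g) (t := {1, 6}) (fun b _ => by simpa using hg2 b)]
    simp
  have hgz : ∀ x, x ≠ 1 → x ≠ 6 → #{b ∈ B | g b = x} = 0 := by
    intro x h0 h2
    refine card_filter_eq_zero_of_forall fun b _ => ?_
    rcases hg2 b with h' | h' <;> rw [h'] <;> exact Ne.symm ‹_›
  have hc := h.card_eq
  have hpos := card_pos.2 h.nonempty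
  refine ⟨#A + 1, #{b ∈ B | g b = 1} + 1, by omega, by omega, by omega, ?_⟩
  refine h.nonempty_iso_blowup heptagon (fun _ => 0) g G₁_adj_heptagon ?_ ?_ ?_ ?_ ?_ ?_
  · intro a ha i
    rw [hA a ha]
    revert i
    decide
  · intro b hb i
    simp only [hg]
    split_ifs with c
    · rw [hB2 b hb c]
      revert i
      decide
    · rw [hB' b hb c]
      revert i
      decide
  · intro a _ b _
    rcases hg2 b with h' | h' <;> rw [h'] <;> decide
  · intro _ _ _ _
    decide
  · intro a _ b _
    rcases hg2 a with h' | h' <;> rw [h'] <;> rcases hg2 b with h' | h' <;> rw [h'] <;> decide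
  · intro x
    rw [card_heptagon_eq]
    fin_cases x <;> simp [hgz] <;> omega

variable [DecidableEq V]

/-- Both sides of the complement consist of clones of vertices of the heptagon: a vertex `b` has
exactly the two neighbours of some vertex `τ`. -/
theorem IsDecomp.seven (h : IsDecomp G 3 p A B) (hE : UncoversAtMostOne G)
    (h3 : ∀ v ∈ A ∪ B, ∀ x y z, G.Adj v (p x) → G.Adj v (p y) → G.Adj v (p z) → x ≠ y → x ≠ z →
        y = z) {a b : V} (ha : a ∈ A) (hb : b ∈ B) {c : ZMod (2 * 3 + 1)} (hca : G.Adj (p c) a) :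
    ∃ τ, (τ = c ∨ τ = c + 2 ∨ τ = c + 5) ∧ ∀ i, G.Adj (p i) b ↔ i = τ + 1 ∨ i = τ + 6 := by
  have key : ∀ x y, G.Adj b (p x) → G.Adj b (p y) → x ≠ y →
      ∀ i, G.Adj (p i) b ↔ i = x ∨ i = y := by
    intro x y hx hy hxy i
    rw [G.adj_comm]
    constructor
    · intro hi
      by_cases hix : i = x
      · exact .inl hix
      · exact .inr (h3 b (by simp [hb]) x y i hx hy hi hxy (Ne.symm hix)).symm
    · rintro (rfl | rfl) <;> assumption
  have h14 := h.adj_or_adj hE ha hb hca 0 1 (by omega) (by omega)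
  have h16 := h.adj_or_adj hE ha hb hca 0 2 (by omega) (by omega)
  have h36 := h.adj_or_adj hE ha hb hca 1 2 (by omega) (by omega)
  norm_num at h14 h16 h36
  have e1 : ∀ c : ZMod (2 * 3 + 1), c + 2 + 1 = c + 3 ∧ c + 2 + 6 = c + 1 ∧
      c + 5 + 1 = c + 6 ∧ c + 5 + 6 = c + 4 ∧ c + 1 ≠ c + 6 ∧ c + 3 ≠ c + 1 ∧ c + 6 ≠ c + 4 := by
    decide
  obtain ⟨e1, e2, e3, e4, n1, n2, n3⟩ := e1 c
  by_cases c1 : G.Adj b (p (c + 1))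
  · by_cases c6 : G.Adj b (p (c + 6))
    · exact ⟨c, by simp, key _ _ c1 c6 n1⟩
    · refine ⟨c + 2, by simp, ?_⟩
      rw [e1, e2]
      exact key _ _ (h36.resolve_right c6) c1 n2
  · refine ⟨c + 5, by simp, ?_⟩
    rw [e3, e4]
    exact key _ _ (h16.resolve_left c1) (h14.resolve_left c1) n3

/-- The clones in `A` and `B` are clones of adjacent vertices of the heptagon. No two vertices of a
heptagon have two common neighbours, so on one side they are clones of the same vertex. -/
theorem IsDecomp.seven_classification (h : IsDecomp G 3 p A B) (hconn : G.Connected)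
    (hE : UncoversAtMostOne G)
    (h3 : ∀ v ∈ A ∪ B, ∀ x y z, G.Adj v (p x) → G.Adj v (p y) → G.Adj v (p z) → x ≠ y → x ≠ z →
        y = z) : F₂₂ G := by
  have h3' : ∀ v ∈ B ∪ A, ∀ x y z, G.Adj v (p x) → G.Adj v (p y) → G.Adj v (p z) → x ≠ y →
      x ≠ z → y = z := fun v hv => h3 v (by rwa [union_comm])
  obtain ⟨a₀, ha₀⟩ := h.nonempty
  obtain ⟨b₀, hb₀⟩ := h.symm.nonempty
  have hAB : (∃ i, ∃ a ∈ A, G.Adj (p i) a) ∧ ∃ i, ∃ b ∈ B, G.Adj (p i) b := by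
    obtain ⟨c, ⟨a, ha, hca⟩ | ⟨b, hb, hcb⟩⟩ := h.exists_adj hconn
    · obtain ⟨τ, -, hτ⟩ := h.seven hE h3 ha hb₀ hca
      exact ⟨⟨c, a, ha, hca⟩, _, b₀, hb₀, (hτ _).2 (.inl rfl)⟩
    · obtain ⟨τ, -, hτ⟩ := h.symm.seven hE h3' hb ha₀ hcb
      exact ⟨⟨_, a₀, ha₀, (hτ _).2 (.inl rfl)⟩, c, b, hb, hcb⟩
  obtain ⟨⟨i, a₁, ha₁, hi⟩, j, b₁, hb₁, hj⟩ := hAB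
  have hA : ∀ a ∈ A, ∃ τ, ∀ i, G.Adj (p i) a ↔ i = τ + 1 ∨ i = τ + 6 := fun a ha =>
    (h.symm.seven hE h3' hb₁ ha hj).imp fun _ => And.right
  have hB : ∀ b ∈ B, ∃ τ, ∀ i, G.Adj (p i) b ↔ i = τ + 1 ∨ i = τ + 6 := fun b hb =>
    (h.seven hE h3 ha₁ hb hi).imp fun _ => And.right
  choose! σ hσ using hA
  choose! τ hτ using hB
  have huniq : ∀ s t : ZMod (2 * 3 + 1), (∀ i, (i = s + 1 ∨ i = s + 6) ↔ (i = t + 1 ∨ i = t + 6)) →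
      s = t := by decide
  have hadj : ∀ a ∈ A, ∀ b ∈ B, τ b = σ a + 1 ∨ τ b = σ a + 6 := by
    intro a ha b hb
    obtain ⟨t, ht, ht'⟩ := h.seven hE h3 ha hb ((hσ a ha _).2 (.inl rfl))
    obtain ⟨u, hu, hu'⟩ := h.seven hE h3 ha hb ((hσ a ha _).2 (.inr rfl))
    obtain rfl := huniq (τ b) t fun i => by rw [← hτ b hb, ht']
    obtain rfl := huniq (τ b) u fun i => by rw [← hτ b hb, hu']
    have : ∀ s t : ZMod (2 * 3 + 1), (t = s + 1 ∨ t = s + 1 + 2 ∨ t = s + 1 + 5) →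
      (t = s + 6 ∨ t = s + 6 + 2 ∨ t = s + 6 + 5) → t = s + 1 ∨ t = s + 6 := by decide
    exact this _ _ ht hu
  -- it suffices that the vertices of one side are clones of the same vertex
  have final : ∀ {A B} (h : IsDecomp G 3 p A B) (σ τ : V → ZMod (2 * 3 + 1)) (t : ZMod (2 * 3 + 1)),
      (∀ a ∈ A, ∀ i, G.Adj (p i) a ↔ i = σ a + 1 ∨ i = σ a + 6) →
      (∀ b ∈ B, ∀ i, G.Adj (p i) b ↔ i = τ b + 1 ∨ i = τ b + 6) →
      (∀ a ∈ A, σ a = t) → (∀ b ∈ B, τ b = t + 1 ∨ τ b = t + 6) → F₂₂ G := by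
    intro A B h σ τ t hσ hτ ht hB
    have e2 : ∀ t i : ZMod (2 * 3 + 1),
      (t + i = t + 1 + 1 ∨ t + i = t + 1 + 6) ↔ (i = 2 ∨ i = 0) := by decide
    have e0 : ∀ t i : ZMod (2 * 3 + 1),
      (t + i = t + 6 + 1 ∨ t + i = t + 6 + 6) ↔ (i = 0 ∨ i = 5) := by decide
    refine (h.rotate t).seven_F₂₂ ?_ ?_
    · intro a ha i
      rw [hσ a ha, ht a ha, add_right_inj, add_right_inj]
    · intro b hb
      rcases hB b hb with h' | h'
      · left
        intro i
        rw [hτ b hb, h']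
        exact e2 t i
      · right
        intro i
        rw [hτ b hb, h']
        exact e0 t i
  by_cases hsame : ∀ a ∈ A, σ a = σ a₀
  · exact final h σ τ (σ a₀) hσ hτ hsame fun b hb => hadj a₀ ha₀ b hb
  · push Not at hsame
    obtain ⟨a, ha, hne⟩ := hsame
    have hmeet : ∀ s s' t t' : ZMod (2 * 3 + 1), s ≠ s' → (t = s + 1 ∨ t = s + 6) →
      (t' = s + 1 ∨ t' = s + 6) → (t = s' + 1 ∨ t = s' + 6) → (t' = s' + 1 ∨ t' = s' + 6) →
      t = t' := by decide
    have hflip : ∀ s t : ZMod (2 * 3 + 1), (t = s + 1 ∨ t = s + 6) → s = t + 1 ∨ s = t + 6 := by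
      decide
    refine final h.symm τ σ (τ b₀) hτ hσ ?_ fun a ha => hflip _ _ (hadj a ha b₀ hb₀)
    intro b hb
    exact hmeet _ _ _ _ hne (hadj a ha b hb) (hadj a ha b₀ hb₀) (hadj a₀ ha₀ b hb)
      (hadj a₀ ha₀ b₀ hb₀)

end

/-! ### From a decomposition back to the graph -/

section

variable {V : Type*} {G : SimpleGraph V} {k : ℕ} {p : ZMod (2 * k + 1) → V} {A B : Finset V}

theorem IsDecomp.connected_induce_compl (h : IsDecomp G k p A B) :
    (G.induce (Set.range p)ᶜ).Connected := by
  have hmem : ∀ v, v ∈ (Set.range p)ᶜ ↔ v ∈ A ∨ v ∈ B := by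
    intro v
    simp only [Set.mem_compl_iff, Set.mem_range]
    refine ⟨fun hv => (h.cover v).resolve_left hv, ?_⟩
    rintro (hv | hv) ⟨i, rfl⟩
    · exact h.notMem_left _ hv
    · exact h.notMem_right _ hv
  obtain ⟨a, ha⟩ := h.nonempty
  obtain ⟨b, hb⟩ := h.symm.nonempty
  refine connected_induce_of_forall ((hmem a).2 (.inl ha)) fun P h0 hstep v hv => ?_
  have hPB : ∀ b ∈ B, P b := fun b hb =>
    hstep _ ((hmem a).2 (.inl ha)) _ ((hmem b).2 (.inr hb)) h0 (h.adj a ha b hb)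
  rcases (hmem v).1 hv with hv' | hv'
  · exact hstep _ ((hmem b).2 (.inr hb)) _ hv (hPB b hb) (h.adj v hv' b hb).symm
  · exact hPB v hv'

theorem IsDecomp.connected (h : IsDecomp G k p A B) {c : ZMod (2 * k + 1)} {a : V} (ha : a ∈ A)
    (hca : G.Adj (p c) a) : G.Connected := by
  rw [← SimpleGraph.Iso.connected_iff (SimpleGraph.induceUnivIso G)]
  refine connected_induce_of_forall (s := p c) trivial fun P h0 hstep v _ => ?_
  have hp : ∀ n : ℕ, P (p (c + n)) := by
    intro n
    induction n with
    | zero => simpa using h0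
    | succ n ih =>
      refine hstep _ trivial _ trivial ih ((h.cyc.adj_iff _ _).2 (.inl ?_))
      push_cast
      ring
  have hB : ∀ b ∈ B, P b := fun b hb =>
    hstep _ trivial _ trivial (hstep _ trivial _ trivial h0 hca) (h.adj a ha b hb)
  rcases h.cover v with ⟨i, rfl⟩ | hv | hv
  · obtain ⟨n, -, rfl⟩ := exists_natCast_add c i
    exact hp n
  · obtain ⟨b, hb⟩ := h.symm.nonempty
    exact hstep _ trivial _ trivial (hB b hb) (h.adj v hv b hb).symm
  · exact hB v hv

variable [Fintype V] [DecidableEq V]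

/-- To avoid `v` in `A`, match an edge from the cycle to `B`; the rest of the cycle is a path with
an even number of vertices, and the rest of `A` and `B` is balanced. -/
theorem IsDecomp.matchable_compl_left (h : IsDecomp G k p A B) {c : ZMod (2 * k + 1)} {b : V}
    (hb : b ∈ B) (hcb : G.Adj (p c) b) {v : V} (hv : v ∈ A) : Matchable G {v}ᶜ := by
  have h1 : Matchable G (A.erase v ∪ B.erase b) := matchable_of_complete_bipartite _ _
    (h.disj.mono (erase_subset _ _) (erase_subset _ _))
    (by rw [card_erase_of_mem hv, card_erase_of_mem hb, h.card_eq])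
    (fun x hx y hy => h.adj x (mem_of_mem_erase hx) y (mem_of_mem_erase hy))
  have h2 := (h.cyc.matchable_erase c).union h1 (by
    rw [disjoint_left]
    intro x hx hx2
    obtain ⟨i, -, rfl⟩ := mem_image.1 (mem_of_mem_erase hx)
    rcases mem_union.1 hx2 with h' | h'
    · exact h.notMem_left _ (mem_of_mem_erase h')
    · exact h.notMem_right _ (mem_of_mem_erase h'))
  have hbA : b ∉ A := fun h' => disjoint_left.1 h.disj h' hb
  have hvB : v ∉ B := fun h' => disjoint_left.1 h.disj hv h'
  have hbp : ∀ i, p i ≠ b := by rintro i rfl; exact h.notMem_right _ hb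
  have hvp : ∀ i, p i ≠ v := by rintro i rfl; exact h.notMem_left _ hv
  have h3 := Matchable.insert hcb (by simp [h.notMem_left, h.notMem_right])
    (by simp [hbA, hbp]) h2
  convert h3 using 1
  ext x
  simp only [mem_compl, mem_singleton, mem_insert, mem_union, mem_erase, mem_image, mem_univ,
    true_and]
  constructor
  · intro hx
    rcases h.cover x with hx' | hx' | hx'
    · by_cases hxc : x = p c <;> simp [hxc, hx']
    · simp [hx, hx']
    · by_cases hxb : x = b <;> simp [hxb, hx']
  · rintro (rfl | rfl | (⟨-, i, rfl⟩ | hx | hx))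
    · exact hvp _
    · rintro rfl; exact hvB hb
    · exact hvp _
    · exact hx.1
    · rintro rfl; exact hvB hx.2

theorem IsDecomp.factorCritical (h : IsDecomp G k p A B) {c d : ZMod (2 * k + 1)} {a b : V}
    (ha : a ∈ A) (hca : G.Adj (p c) a) (hb : b ∈ B) (hdb : G.Adj (p d) b) : FactorCritical G := by
  refine factorCritical_of_matchable fun v => ?_
  rcases h.cover v with ⟨i, rfl⟩ | hv | hv
  · have h1 := (h.cyc.matchable_erase i).union
      (matchable_of_complete_bipartite A B h.disj h.card_eq h.adj) (by
        rw [disjoint_left]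
        intro x hx hx2
        obtain ⟨i, -, rfl⟩ := mem_image.1 (mem_of_mem_erase hx)
        rcases mem_union.1 hx2 with h' | h'
        · exact h.notMem_left _ h'
        · exact h.notMem_right _ h')
    convert h1 using 1
    ext x
    simp only [mem_compl, mem_singleton, mem_union, mem_erase, mem_image, mem_univ, true_and]
    have := h.cover x
    constructor
    · tauto
    · rintro (h' | h' | h')
      · exact h'.1
      · rintro rfl; exact h.notMem_left _ h'
      · rintro rfl; exact h.notMem_right _ h'
  · exact h.matchable_compl_left hb hdb hv
  · exact h.symm.matchable_compl_left ha hca hv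

end

/-! ### Blow-ups with a prescribed decomposition -/

theorem cliqueFree_of_classes {V ι : Type*} {G : SimpleGraph V} {H : SimpleGraph ι} {cl : V → ι}
    (hcl : ∀ v w, G.Adj v w ↔ H.Adj (cl v) (cl w))
    (hH : ∀ i j l, H.Adj i j → H.Adj j l → ¬ H.Adj i l) : G.CliqueFree 3 := by
  classical
  intro s hs
  obtain ⟨a, b, c, hab, hac, hbc, -⟩ := SimpleGraph.is3Clique_iff.1 hs
  exact hH _ _ _ ((hcl _ _).1 hab) ((hcl _ _).1 hbc) ((hcl _ _).1 hac)

/-- The numbers of edges of a matching between the classes of a blow-up. -/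
theorem exists_edge_counts {V ι : Type*} [DecidableEq V] [DecidableEq ι] [Fintype ι]
    {G : SimpleGraph V} {H : SimpleGraph ι} {cl : V → ι}
    (hcl : ∀ v w, G.Adj v w ↔ H.Adj (cl v) (cl w))
    {S : Finset V} (hS : Matchable G S) : ∃ x : ι → ι → ℕ, (∀ i j, x i j = x j i) ∧
      (∀ i j, ¬ H.Adj i j → x i j = 0) ∧ ∀ i, ∑ j, x i j = #{v ∈ S | cl v = i} := by
  induction hS with
  | empty => exact ⟨fun _ _ => 0, by simp, by simp, by simp⟩
  | @insert a b S hab ha hb _ ih =>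
    obtain ⟨x, h1, h2, h3⟩ := ih
    refine ⟨fun i j => x i j + (if i = cl a ∧ j = cl b then 1 else 0) +
      (if i = cl b ∧ j = cl a then 1 else 0), fun i j => ?_, fun i j hij => ?_, fun i => ?_⟩
    · simp only [h1 i j, and_comm (a := j = cl a), and_comm (a := j = cl b)]
      omega
    · have hab' := (hcl a b).1 hab
      have e1 : ¬ (i = cl a ∧ j = cl b) := by
        rintro ⟨rfl, rfl⟩
        exact hij hab'
      have e2 : ¬ (i = cl b ∧ j = cl a) := by
        rintro ⟨rfl, rfl⟩
        exact hij hab'.symm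
      simp [h2 i j hij, e1, e2]
    · have hsum : ∀ u w : V, ∑ j, (if i = cl u ∧ j = cl w then 1 else 0) =
          if cl u = i then 1 else 0 := by
        intro u w
        by_cases hu : i = cl u
        · simp [hu]
        · simp [hu, Ne.symm hu]
      rw [sum_add_distrib, sum_add_distrib, h3, hsum, hsum, filter_insert, filter_insert]
      have hab' := hab.ne
      split_ifs <;> simp [*]

section

variable {V : Type*} [Fintype V] [DecidableEq V] {G : SimpleGraph V} {ι : Type} [DecidableEq ι]
  {H : SimpleGraph ι} {m : ι → ℕ} {cl : V → ι}

/-- A decomposition of a blow-up: the cycle `t` of `H` lifts to a cycle of `G`, and the vertices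
off this lift form a balanced complete bipartite graph whose parts lie over `SA` and `SB`. -/
theorem properties_of_classes (hcl : ∀ v w, G.Adj v w ↔ H.Adj (cl v) (cl w))
    (hm : ∀ i, #{v | cl v = i} = m i) {k : ℕ} (hk : 1 ≤ k) (t : ZMod (2 * k + 1) → ι)
    (htinj : Function.Injective t) (ht : ∀ i j, H.Adj (t i) (t j) ↔ j = i + 1 ∨ i = j + 1)
    (htm : ∀ i, 1 ≤ m (t i)) (SA SB : Finset ι) (hdisj : Disjoint SA SB)
    (hother : ∀ x, x ∉ SA → x ∉ SB → m x = #{i | t i = x})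
    (hAB : ∀ x ∈ SA, ∀ y ∈ SB, H.Adj x y) (hAA : ∀ x ∈ SA, ∀ y ∈ SA, ¬ H.Adj x y)
    (hBB : ∀ x ∈ SB, ∀ y ∈ SB, ¬ H.Adj x y) (hA : ∀ x ∈ SA, ∃ i, H.Adj (t i) x)
    (hB : ∀ x ∈ SB, ∃ i, H.Adj (t i) x) {n : ℕ} (hn : 1 ≤ n)
    (hnA : ∑ x ∈ SA, m x = n + #{i | t i ∈ SA}) (hnB : ∑ x ∈ SB, m x = n + #{i | t i ∈ SB}) :
    G.Connected ∧ FactorCritical G ∧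
      ∃ C : Set V, IsInducedOddCycle G C ∧ (G.induce Cᶜ).Connected := by
  classical
  have hex : ∀ i, ∃ v, cl v = t i := by
    intro i
    have h1 := htm i
    rw [← hm, one_le_card] at h1
    obtain ⟨v, hv⟩ := h1
    exact ⟨v, (mem_filter.1 hv).2⟩
  choose p hp using hex
  have hpinj : Function.Injective p := fun i j hij => htinj (by rw [← hp, ← hp, hij])
  have hcard : ∀ S : Finset ι, #{v | cl v ∈ S ∧ ∀ i, p i ≠ v} + #{i | t i ∈ S} =
      ∑ x ∈ S, m x := by
    intro S
    have h1 : #{i | t i ∈ S} = #((univ.filter fun i => t i ∈ S).image p) :=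
      (card_image_of_injective _ hpinj).symm
    rw [h1, ← card_union_of_disjoint]
    · have h2 : ((univ.filter fun v => cl v ∈ S ∧ ∀ i, p i ≠ v) ∪
          (univ.filter fun i => t i ∈ S).image p) = univ.filter fun v => cl v ∈ S := by
        ext v
        simp only [mem_union, mem_filter, mem_univ, true_and, mem_image]
        constructor
        · rintro (h | ⟨i, hi, rfl⟩)
          · exact h.1
          · rwa [hp]
        · intro h
          by_cases hv : ∃ i, p i = v
          · obtain ⟨i, rfl⟩ := hv
            exact .inr ⟨i, by rwa [← hp], rfl⟩
          · push Not at hv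
            exact .inl ⟨h, hv⟩
      rw [h2, card_eq_sum_card_fiberwise (f := cl) (t := S) (fun v hv => by simpa using hv)]
      refine sum_congr rfl fun x hx => ?_
      rw [← hm x, filter_filter]
      congr 1
      ext v
      simp only [mem_filter, mem_univ, true_and]
      exact ⟨And.right, fun h => ⟨h ▸ hx, h⟩⟩
    · rw [disjoint_left]
      intro v hv hv2
      obtain ⟨i, -, rfl⟩ := mem_image.1 hv2
      exact (mem_filter.1 hv).2.2 i rfl
  have hdec : IsDecomp G k p (univ.filter fun v => cl v ∈ SA ∧ ∀ i, p i ≠ v)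
      (univ.filter fun v => cl v ∈ SB ∧ ∀ i, p i ≠ v) := by
    refine ⟨⟨hpinj, fun i j => by rw [hcl, hp, hp, ht]⟩, ?_, by simp, by simp, ?_, ?_, ?_, ?_, ?_,
      ?_⟩
    · rw [disjoint_left]
      intro v hv hv2
      exact disjoint_left.1 hdisj (mem_filter.1 hv).2.1 (mem_filter.1 hv2).2.1
    · intro v
      by_contra hcon
      simp only [mem_filter, mem_univ, true_and, not_or, not_exists] at hcon
      have hvA : cl v ∉ SA := fun h => hcon.2.1 ⟨h, hcon.1⟩
      have hvB : cl v ∉ SB := fun h => hcon.2.2 ⟨h, hcon.1⟩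
      -- outside `SA ∪ SB` the classes are exhausted by the cycle
      have h1 := hother _ hvA hvB
      have h2 : #((univ.filter fun i => t i = cl v).image p) < #{w | cl w = cl v} := by
        refine card_lt_card ⟨?_, fun h => ?_⟩
        · intro w hw
          obtain ⟨i, hi, rfl⟩ := mem_image.1 hw
          simpa [hp] using hi
        · obtain ⟨i, -, hi⟩ := mem_image.1 (h (mem_filter.2 ⟨mem_univ v, rfl⟩))
          exact hcon.1 i hi
      rw [card_image_of_injective _ hpinj, hm] at h2
      omega
    · have h1 := hcard SA
      have h2 := hcard SB
      omega
    · have h1 := hcard SA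
      rw [← card_pos]
      omega
    · intro a ha b hb
      exact (hcl _ _).2 (hAB _ (mem_filter.1 ha).2.1 _ (mem_filter.1 hb).2.1)
    · intro a ha b hb
      rw [hcl]
      exact hAA _ (mem_filter.1 ha).2.1 _ (mem_filter.1 hb).2.1
    · intro a ha b hb
      rw [hcl]
      exact hBB _ (mem_filter.1 ha).2.1 _ (mem_filter.1 hb).2.1
  obtain ⟨a, ha⟩ := hdec.nonempty
  obtain ⟨b, hb⟩ := hdec.symm.nonempty
  obtain ⟨c, hc⟩ := hA _ (mem_filter.1 ha).2.1
  obtain ⟨d, hd⟩ := hB _ (mem_filter.1 hb).2.1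
  rw [← hp, ← hcl] at hc hd
  exact ⟨hdec.connected ha hc, hdec.factorCritical ha hc hb hd, Set.range p,
    isInducedOddCycle_iff.2 ⟨k, hk, p, hdec.cyc, rfl⟩, hdec.connected_induce_compl⟩

/-- In a blow-up, equimatchability can be checked on the numbers `x i j` of matching edges between
classes and the numbers `y i` of uncovered vertices in the classes. -/
theorem uncoversAtMostOne_of_classes [Fintype ι] (hcl : ∀ v w, G.Adj v w ↔ H.Adj (cl v) (cl w))
    (hm : ∀ i, #{v | cl v = i} = m i)
    (h : ∀ (x : ι → ι → ℕ) (y : ι → ℕ), (∀ i j, x i j = x j i) → (∀ i j, ¬ H.Adj i j → x i j = 0) →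
      (∀ i, ∑ j, x i j + y i = m i) → (∀ i j, H.Adj i j → y i = 0 ∨ y j = 0) → ∑ i, y i ≤ 1) :
    UncoversAtMostOne G := by
  intro S hS hind
  obtain ⟨x, h1, h2, h3⟩ := exists_edge_counts hcl hS
  have key := h x (fun i => #{v ∈ Sᶜ | cl v = i}) h1 h2 (fun i => ?_) (fun i j hij => ?_)
  · rwa [card_eq_sum_card_fiberwise (f := cl) (t := univ) (fun v _ => by simp)]
  · rw [h3, ← hm i, ← card_union_of_disjoint, ← filter_union, union_compl]
    exact disjoint_filter_filter (disjoint_compl_right)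
  · by_contra hcon
    simp only [card_eq_zero, not_or, ← ne_eq, ← nonempty_iff_ne_empty] at hcon
    obtain ⟨⟨v, hv⟩, w, hw⟩ := hcon
    simp only [mem_filter, mem_compl] at hv hw
    exact hind v hv.1 w hw.1 ((hcl v w).2 (by rwa [hv.2, hw.2]))

end

/-! ### The families consist of graphs with the required properties -/

theorem G₁_triangle_free : ∀ i j l, G₁.Adj i j → G₁.Adj j l → ¬ G₁.Adj i l := by
  decide

theorem G₂_triangle_free : ∀ i j l, G₂.Adj i j → G₂.Adj j l → ¬ G₂.Adj i l := by
  decide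

theorem sum_eq_sum_of_neighbors {ι : Type*} [Fintype ι] {H : SimpleGraph ι} [DecidableRel H.Adj]
    {x : ι → ι → ℕ} (hz : ∀ i j, ¬ H.Adj i j → x i j = 0) {i : ι} {s : Finset ι}
    (hs : univ.filter (H.Adj i) = s) : ∑ j, x i j = ∑ j ∈ s, x i j := by
  rw [← hs, sum_filter_of_ne]
  intro j _ hj
  by_contra h
  exact hj (hz i j h)

/-- The classes of a blow-up of `G₁`, split according to the partners of their vertices. -/
theorem G₁_counts {x : Fin 7 → Fin 7 → ℕ} {y m : Fin 7 → ℕ} (hs : ∀ i j, x i j = x j i)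
    (hz : ∀ i j, ¬ G₁.Adj i j → x i j = 0) (hm : ∀ i, ∑ j, x i j + y i = m i) :
    x 0 1 + x 0 6 + y 0 = m 0 ∧ x 0 1 + x 1 2 + y 1 = m 1 ∧ x 1 2 + x 2 3 + y 2 = m 2 ∧
    x 2 3 + x 3 4 + y 3 = m 3 ∧ x 3 4 + x 4 5 + y 4 = m 4 ∧ x 4 5 + x 5 6 + y 5 = m 5 ∧
    x 0 6 + x 5 6 + y 6 = m 6 := by
  have h0 := sum_eq_sum_of_neighbors hz (i := 0) (s := {1, 6}) (by decide)
  have h1 := sum_eq_sum_of_neighbors hz (i := 1) (s := {0, 2}) (by decide)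
  have h2 := sum_eq_sum_of_neighbors hz (i := 2) (s := {1, 3}) (by decide)
  have h3 := sum_eq_sum_of_neighbors hz (i := 3) (s := {2, 4}) (by decide)
  have h4 := sum_eq_sum_of_neighbors hz (i := 4) (s := {3, 5}) (by decide)
  have h5 := sum_eq_sum_of_neighbors hz (i := 5) (s := {4, 6}) (by decide)
  have h6 := sum_eq_sum_of_neighbors hz (i := 6) (s := {0, 5}) (by decide)
  simp only [← hm, h0, h1, h2, h3, h4, h5, h6, sum_pair (show (1 : Fin 7) ≠ 6 by decide),
    sum_pair (show (0 : Fin 7) ≠ 2 by decide), sum_pair (show (1 : Fin 7) ≠ 3 by decide),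
    sum_pair (show (2 : Fin 7) ≠ 4 by decide), sum_pair (show (3 : Fin 7) ≠ 5 by decide),
    sum_pair (show (4 : Fin 7) ≠ 6 by decide), sum_pair (show (0 : Fin 7) ≠ 5 by decide),
    hs 1 0, hs 2 1, hs 3 2, hs 4 3, hs 5 4, hs 6 5, hs 6 0, and_self]

/-- The classes of a blow-up of `G₂`, split according to the partners of their vertices. -/
theorem G₂_counts {x : Fin 11 → Fin 11 → ℕ} {y m : Fin 11 → ℕ} (hs : ∀ i j, x i j = x j i)
    (hz : ∀ i j, ¬ G₂.Adj i j → x i j = 0) (hm : ∀ i, ∑ j, x i j + y i = m i) :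
    x 0 1 + x 0 5 + y 0 = m 0 ∧ x 0 1 + x 1 2 + x 1 4 + y 1 = m 1 ∧ x 1 2 + x 2 3 + y 2 = m 2 ∧
    x 2 3 + x 3 4 + x 3 7 + x 3 8 + y 3 = m 3 ∧ x 1 4 + x 3 4 + x 4 5 + y 4 = m 4 ∧
    x 0 5 + x 4 5 + x 5 6 + y 5 = m 5 ∧ x 5 6 + x 6 7 + x 6 10 + y 6 = m 6 ∧
    x 3 7 + x 6 7 + x 7 9 + y 7 = m 7 ∧ x 3 8 + x 8 9 + y 8 = m 8 ∧
    x 7 9 + x 8 9 + x 9 10 + y 9 = m 9 ∧ x 6 10 + x 9 10 + y 10 = m 10 := by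
  have h0 := sum_eq_sum_of_neighbors hz (i := 0) (s := {1, 5}) (by decide)
  have h1 := sum_eq_sum_of_neighbors hz (i := 1) (s := {0, 2, 4}) (by decide)
  have h2 := sum_eq_sum_of_neighbors hz (i := 2) (s := {1, 3}) (by decide)
  have h3 := sum_eq_sum_of_neighbors hz (i := 3) (s := {2, 4, 7, 8}) (by decide)
  have h4 := sum_eq_sum_of_neighbors hz (i := 4) (s := {1, 3, 5}) (by decide)
  have h5 := sum_eq_sum_of_neighbors hz (i := 5) (s := {0, 4, 6}) (by decide)
  have h6 := sum_eq_sum_of_neighbors hz (i := 6) (s := {5, 7, 10}) (by decide)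
  have h7 := sum_eq_sum_of_neighbors hz (i := 7) (s := {3, 6, 9}) (by decide)
  have h8 := sum_eq_sum_of_neighbors hz (i := 8) (s := {3, 9}) (by decide)
  have h9 := sum_eq_sum_of_neighbors hz (i := 9) (s := {7, 8, 10}) (by decide)
  have h10 := sum_eq_sum_of_neighbors hz (i := 10) (s := {6, 9}) (by decide)
  simp +decide only [sum_insert, sum_singleton, mem_insert, mem_singleton,
    not_false_eq_true] at h0 h1 h2 h3 h4 h5 h6 h7 h8 h9 h10
  rw [← hm 0, ← hm 1, ← hm 2, ← hm 3, ← hm 4, ← hm 5, ← hm 6, ← hm 7, ← hm 8, ← hm 9, ← hm 10,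
    h0, h1, h2, h3, h4, h5, h6, h7, h8, h9, h10]
  rw [hs 1 0, hs 2 1, hs 3 2, hs 4 1, hs 4 3, hs 5 0, hs 5 4, hs 6 5, hs 7 3, hs 7 6,
    hs 8 3, hs 9 7, hs 9 8, hs 10 6, hs 10 9]
  omega

/-- The properties asserted of the graphs in the families. -/
def Good {V : Type*} (G : SimpleGraph V) : Prop :=
  G.Connected ∧ G.CliqueFree 3 ∧ Equimatchable G ∧ FactorCritical G ∧
    ∃ C : Set V, IsInducedOddCycle G C ∧ (G.induce Cᶜ).Connected

section

variable {V : Type*} [Finite V] {G : SimpleGraph V}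

theorem good_of_IsG₁ {n r : ℕ} (hn : 2 ≤ n) (hr : 1 ≤ r) (hrn : r ≤ n)
    (h : IsG₁ G ![n, r, 1, 1, 1, 1, n - r + 1]) : Good G := by
  classical
  cases nonempty_fintype V
  obtain ⟨cl, hcl, hm⟩ := nonempty_iso_blowup_iff.1 h
  obtain ⟨h1, h2, h3⟩ := properties_of_classes hcl hm (k := 3) (by omega) heptagon (by decide)
    G₁_adj_heptagon (by refine forall_zmod_seven ?_ ?_ ?_ ?_ ?_ ?_ ?_ <;> simp [heptagon] <;> omega)
    {0} {1, 6} (by decide)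
    (by
      intro x
      rw [card_heptagon_eq]
      fin_cases x <;> simp)
    (by decide) (by decide) (by decide) (by decide) (by decide) (n := n - 1) (by omega)
    (by
      rw [show #{i | heptagon i ∈ ({0} : Finset (Fin 7))} = 1 by decide]
      simp; omega)
    (by
      rw [show #{i | heptagon i ∈ ({1, 6} : Finset (Fin 7))} = 2 by decide]
      simp; omega)
  refine ⟨h1, cliqueFree_of_classes hcl G₁_triangle_free, ?_, h2, h3⟩
  refine UncoversAtMostOne.equimatchable (uncoversAtMostOne_of_classes hcl hm ?_)
  intro x y hs hz hm hy
  have hc := G₁_counts hs hz hm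
  simp at hc
  have e1 := hy 0 1 (by decide)
  have e2 := hy 1 2 (by decide)
  have e3 := hy 2 3 (by decide)
  have e4 := hy 3 4 (by decide)
  have e5 := hy 4 5 (by decide)
  have e6 := hy 5 6 (by decide)
  have e7 := hy 0 6 (by decide)
  simp only [Fin.sum_univ_seven]
  omega

/-- The graphs of `F₁₁`, and those of `F₂₁` in which the class of `u₅` is nonempty. -/
theorem good_of_single {n r s : ℕ} (hn : 1 ≤ n) (hrs : r + s ≤ n)
    (h : IsG₂ G ![r, n, s, 1, n + 1 - (r + s), 1, 1, 1, 0, 0, 0]) : Good G := by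
  classical
  cases nonempty_fintype V
  obtain ⟨cl, hcl, hm⟩ := nonempty_iso_blowup_iff.1 h
  obtain ⟨h1, h2, h3⟩ := properties_of_classes hcl hm (k := 2) (by omega) pentagon₁ (by decide)
    G₂_adj_pentagon₁ (by refine forall_zmod_five ?_ ?_ ?_ ?_ ?_ <;> simp [pentagon₁]; omega)
    {1} {0, 2, 4} (by decide)
    (by
      intro x
      rw [card_pentagon₁_eq]
      fin_cases x <;> simp)
    (by decide) (by decide) (by decide) (by decide) (by decide) (n := n) (by omega)
    (by
      rw [show #{i | pentagon₁ i ∈ ({1} : Finset (Fin 11))} = 0 by decide]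
      simp)
    (by
      rw [show #{i | pentagon₁ i ∈ ({0, 2, 4} : Finset (Fin 11))} = 1 by decide]
      simp; omega)
  refine ⟨h1, cliqueFree_of_classes hcl G₂_triangle_free, ?_, h2, h3⟩
  refine UncoversAtMostOne.equimatchable (uncoversAtMostOne_of_classes hcl hm ?_)
  intro x y hs hz hm hy
  have hc := G₂_counts hs hz hm
  simp at hc
  have e1 := hy 5 0 (by decide)
  have e2 := hy 5 6 (by decide)
  have e3 := hy 3 2 (by decide)
  have e4 := hy 1 2 (by decide)
  have e5 := hy 1 0 (by decide)
  have e6 := hy 6 7 (by decide)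
  have e7 := hy 5 4 (by decide)
  have e8 := hy 1 4 (by decide)
  have e9 := hy 3 4 (by decide)
  have e10 := hy 3 7 (by decide)
  simp only [Fin.sum_univ_succ, Fin.sum_univ_zero]
  simp
  -- once the vanishing of `y 1`, `y 5` and `y 3` is decided, at most three alternatives are open
  rcases Nat.eq_zero_or_pos (y 1) with d1 | d1
  · clear e4 e5 e8
    rcases Nat.eq_zero_or_pos (y 5) with d5 | d5
    · clear e1 e2 e7
      rcases Nat.eq_zero_or_pos (y 3) with d3 | d3
      · clear e3 e9 e10
        omega
      · replace e3 := e3.resolve_left d3.ne'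
        replace e9 := e9.resolve_left d3.ne'
        replace e10 := e10.resolve_left d3.ne'
        clear e6
        omega
    · replace e1 := e1.resolve_left d5.ne'
      replace e2 := e2.resolve_left d5.ne'
      replace e7 := e7.resolve_left d5.ne'
      clear e6 e9
      omega
  · replace e4 := e4.resolve_left d1.ne'
    replace e5 := e5.resolve_left d1.ne'
    replace e8 := e8.resolve_left d1.ne'
    clear e1 e3 e7 e9
    omega

theorem good_of_F₃ (h : F₃ G) : Good G := by
  classical
  cases nonempty_fintype V
  obtain ⟨n, r, s, hn, hr, hrn, hs, hsn, h⟩ := h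
  obtain ⟨cl, hcl, hm⟩ := nonempty_iso_blowup_iff.1 h
  obtain ⟨h1, h2, h3⟩ := properties_of_classes hcl hm (k := 2) (by omega) pentagon₂ (by decide)
    G₂_adj_pentagon₂ (by refine forall_zmod_five ?_ ?_ ?_ ?_ ?_ <;> simp [pentagon₂] <;> omega)
    {6, 9} {7, 10} (by decide)
    (by
      intro x
      rw [card_pentagon₂_eq]
      fin_cases x <;> simp)
    (by decide) (by decide) (by decide) (by decide) (by decide) (n := n) (by omega)
    (by
      rw [show #{i | pentagon₂ i ∈ ({6, 9} : Finset (Fin 11))} = 1 by decide]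
      simp; omega)
    (by
      rw [show #{i | pentagon₂ i ∈ ({7, 10} : Finset (Fin 11))} = 1 by decide]
      simp; omega)
  refine ⟨h1, cliqueFree_of_classes hcl G₂_triangle_free, ?_, h2, h3⟩
  refine UncoversAtMostOne.equimatchable (uncoversAtMostOne_of_classes hcl hm ?_)
  intro x y hs hz hm hy
  have hc := G₂_counts hs hz hm
  simp at hc
  have e1 := hy 6 5 (by decide)
  have e2 := hy 6 10 (by decide)
  have e3 := hy 10 9 (by decide)
  have e4 := hy 6 7 (by decide)
  have e5 := hy 5 4 (by decide)
  have e6 := hy 7 9 (by decide)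
  have e7 := hy 3 4 (by decide)
  have e8 := hy 7 3 (by decide)
  simp only [Fin.sum_univ_succ, Fin.sum_univ_zero]
  simp
  -- once the vanishing of `y 6` and `y 7` is decided, at most two alternatives are open
  rcases Nat.eq_zero_or_pos (y 6) with d6 | d6
  · clear e1 e2 e4
    rcases Nat.eq_zero_or_pos (y 7) with d7 | d7
    · clear e6 e8
      omega
    · replace e6 := e6.resolve_left d7.ne'
      replace e8 := e8.resolve_left d7.ne'
      clear e3 e7
      omega
  · replace e1 := e1.resolve_left d6.ne'
    replace e2 := e2.resolve_left d6.ne'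
    replace e4 := e4.resolve_left d6.ne'
    clear e3 e5 e6 e8
    omega

theorem good_of_F₄ (h : F₄ G) : Good G := by
  classical
  cases nonempty_fintype V
  obtain ⟨n, r, s, hn, hr, hrn, hs, hsn, hrs, h⟩ := h
  obtain ⟨cl, hcl, hm⟩ := nonempty_iso_blowup_iff.1 h
  obtain ⟨h1, h2, h3⟩ := properties_of_classes hcl hm (k := 2) (by omega) pentagon₂ (by decide)
    G₂_adj_pentagon₂ (by refine forall_zmod_five ?_ ?_ ?_ ?_ ?_ <;> simp [pentagon₂] <;> omega)
    {6} {5, 7, 10} (by decide)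
    (by
      intro x
      rw [card_pentagon₂_eq]
      fin_cases x <;> simp)
    (by decide) (by decide) (by decide) (by decide) (by decide) (n := n) (by omega)
    (by
      rw [show #{i | pentagon₂ i ∈ ({6} : Finset (Fin 11))} = 1 by decide]
      simp)
    (by
      rw [show #{i | pentagon₂ i ∈ ({5, 7, 10} : Finset (Fin 11))} = 2 by decide]
      simp; omega)
  refine ⟨h1, cliqueFree_of_classes hcl G₂_triangle_free, ?_, h2, h3⟩
  refine UncoversAtMostOne.equimatchable (uncoversAtMostOne_of_classes hcl hm ?_)
  intro x y hs hz hm hy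
  have hc := G₂_counts hs hz hm
  simp at hc
  have e1 := hy 5 6 (by decide)
  have e2 := hy 6 10 (by decide)
  have e4 := hy 6 7 (by decide)
  have e5 := hy 5 4 (by decide)
  have e7 := hy 3 4 (by decide)
  have e8 := hy 3 7 (by decide)
  simp only [Fin.sum_univ_succ, Fin.sum_univ_zero]
  simp
  omega

/-- If the class of `u₅` is empty, the graphs of `F₂₁` are blow-ups of the heptagon
`u₂ u₁ u₆ u₇ u₈ u₄ u₃`. -/
theorem isG₁_of_isG₂ {n r s : ℕ}
    (h : IsG₂ G ![r, n, s, 1, 0, 1, 1, 1, 0, 0, 0]) : IsG₁ G ![n, r, 1, 1, 1, 1, s] := by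
  classical
  cases nonempty_fintype V
  obtain ⟨cl, hcl, hm⟩ := nonempty_iso_blowup_iff.1 h
  set f : Fin 11 → Fin 7 := ![1, 0, 6, 5, 0, 2, 3, 4, 0, 0, 0] with hf
  have hne : ∀ v, cl v ≠ 4 ∧ cl v ≠ 8 ∧ cl v ≠ 9 ∧ cl v ≠ 10 := by
    have : ∀ i, (![r, n, s, 1, 0, 1, 1, 1, 0, 0, 0] : Fin 11 → ℕ) i = 0 → ∀ v, cl v ≠ i := by
      intro i hi v hv
      rw [← hm i, card_eq_zero, filter_eq_empty_iff] at hi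
      exact hi (mem_univ v) hv
    exact fun v => ⟨this 4 rfl v, this 8 rfl v, this 9 rfl v, this 10 rfl v⟩
  refine nonempty_iso_blowup_iff.2 ⟨fun v => f (cl v), fun v w => ?_, fun i => ?_⟩
  · have key : ∀ i j : Fin 11, (i ≠ 4 ∧ i ≠ 8 ∧ i ≠ 9 ∧ i ≠ 10) →
        (j ≠ 4 ∧ j ≠ 8 ∧ j ≠ 9 ∧ j ≠ 10) → (G₂.Adj i j ↔ G₁.Adj (f i) (f j)) := by
      decide
    rw [hcl, key _ _ (hne v) (hne w)]
  · have key : ∀ (i : Fin 7) (j : Fin 11), (j ≠ 4 ∧ j ≠ 8 ∧ j ≠ 9 ∧ j ≠ 10) →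
        (f j = i ↔ j = (![1, 0, 5, 6, 7, 3, 2] : Fin 7 → Fin 11) i) := by
      decide
    simp only [key i _ (hne _)]
    rw [hm]
    fin_cases i <;> rfl

end
end EFC

theorem mainTheorem2 {V : Type*} [Finite V] (G : SimpleGraph V) :
    (G.Connected ∧ G.CliqueFree 3 ∧ EFC.Equimatchable G ∧ EFC.FactorCritical G ∧
      ∃ C : Set V, EFC.IsInducedOddCycle G C ∧ (G.induce Cᶜ).Connected) ↔
    (EFC.F₁₁ G ∨ EFC.F₁₂ G ∨ EFC.F₂₁ G ∨ EFC.F₂₂ G ∨ EFC.F₃ G ∨ EFC.F₄ G) := by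
  classical
  constructor
  · rintro ⟨hconn, hG, heq, hfc, hC⟩
    cases nonempty_fintype V
    have := hconn.nonempty
    have hE := EFC.uncoversAtMostOne_of_equimatchable heq hfc
    obtain ⟨k, rfl | rfl, p, A, B, h, h3⟩ := EFC.exists_short_isDecomp hconn hG hE hC
    · have := h.five_classification hconn hG hE
      tauto
    · have := h.seven_classification hconn hE h3
      tauto
  · rintro (⟨n, hn, h⟩ | ⟨n, hn, h⟩ | ⟨n, r, s, hn, hr, hs, hrs, h⟩ |
      ⟨n, r, hn, hr, hrn, h⟩ | h | h)
    · exact EFC.good_of_single (r := n) (s := 0) hn (by omega) (by simpa using h)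
    · exact EFC.good_of_IsG₁ (r := n) hn (by omega) le_rfl (by simpa using h)
    · by_cases hlt : r + s ≤ n
      · exact EFC.good_of_single hn hlt h
      · -- the class of `u₅` is empty
        have h' : EFC.IsG₂ G ![r, n, s, 1, 0, 1, 1, 1, 0, 0, 0] := by
          rwa [show n + 1 - (r + s) = 0 by omega] at h
        obtain rfl : s = n - r + 1 := by omega
        exact EFC.good_of_IsG₁ (by omega) (by omega) (by omega) (EFC.isG₁_of_isG₂ h')
    · exact EFC.good_of_IsG₁ hn hr hrn h
    · exact EFC.good_of_F₃ h
    · exact EFC.good_of_F₄ h
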